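/- Let $\sigma\neq\emptyset$ and $\bar\sigma$ be complementary finite sets of coordinates, $n=|\sigma|$, and write $z=(z_\sigma,z_{\bar\sigma})\in\mathbb R^{\sigma}\times\mathbb R^{\bar\sigma}$. Let $p$ be a probability density on $\mathbb R^{\sigma}\times\mathbb R^{\bar\sigma}$ such that $z_\sigma$ has finite second moments under $p$, and let $\mu_\sigma$ and $\Sigma_{\sigma\sigma}$ be the mean and covariance matrix of $z_\sigma$ under $p$. Let $p(z_\sigma|z_{\bar\sigma})$ denote the conditional density, defined for every $z_{\bar\sigma}$ with $0<p(z_{\bar\sigma})=\int p(z_\sigma,z_{\bar\sigma})\,dz_\sigma<\infty$. Let $\mathcal Q$ be the family of nondegenerate Gaussians $q=\mathcal N(\nu,S)$, $S$ positive definite, on the same space, and assume that $\mathrm{KL}(q\|p)<\infty$ for at least one $q\in\mathcal Q$. Suppose there are a point $m\in\mathbb R^{\sigma}$ and a positive-definite matrix $M\in\mathbb R^{\sigma\times\sigma}$ with $\operatorname{trace}(M)=n$, both independent of $z_{\bar\sigma}$, such that for every such $z_{\bar\sigma}$ the function $g=p(\,\cdot\,|z_{\bar\sigma})$ on $\mathbb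 R^\sigma$ satisfies: (a) (elliptical symmetry) $g(z)=g(z')$ whenever $(z-m)^TM^{-1}(z-m)=(z'-m)^TM^{-1}(z'-m)$; (b) (regularity) with $p_0(t)=g(m+M^{1/2}t)\,|M|^{1/2}$, the function $f:[0,\infty)\to\mathbb R$ given by $f(\|t\|)=\log p_0(t)$ is continuously differentiable on $[0,\infty)$, with a finite one-sided derivative at $0$; (c) (somewhere-strict log concavity) $g>0$, $\log g$ is concave on $\mathbb R^{\sigma}$, and $\log g$ is strictly concave on some nonempty open set. (Here $p_0$, $f$ and the open set may depend on $z_{\bar\sigma}$.) Then any $q=\mathcal N(\nu,S)$ that minimizes $\mathrm{KL}(q\|p)$ over $\mathcal Q$ satisfies $$\nu_\sigma=\mu_\sigma\qquad\text{and}\qquad S_{\sigma\sigma}=\gamma^2\,\Sigma_{\sigma\sigma}\ \text{ for a unique } \gamma>0.$$ Moreover, $\gamma$ depends on the minimizer only through its marginal along $\bar\sigma$: two minimizers with equal $\nu_{\bar\sigma}$ and equal $S_{\bar\sigma\bar\sigma}$ have the same $S_{\sigma\sigma}$. If $p(z_\sigma|z_{\bar\sigma})$ does not depend on $z_{\bar\sigma}$,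 then all minimizers have the same $S_{\sigma\sigma}$, hence the same $\gamma$. -/

import Mathlib

open MeasureTheory ProbabilityTheory InformationTheory
open scoped ENNReal MatrixOrder

noncomputable section

namespace PartialVI

/-- `g` is a probability density with respect to Lebesgue measure. -/
structure IsProbDensity {E : Type*} [MeasureSpace E] (g : E → ℝ) : Prop where
  measurable : Measurable g
  nonneg : ∀ z, 0 ≤ g z
  integral_eq_one : ∫ z, g z = 1

/-- The probability measure with density `g`. -/
def densityMeasure {E : Type*} [MeasureSpace E] (g : E → ℝ) : Measure E :=
  volume.withDensity fun z => ENNReal.ofReal (g z)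

/-- The vector of first moments. -/
def meanVec {ι : Type*} (P : Measure (EuclideanSpace ℝ ι)) : ι → ℝ :=
  fun i => ∫ z, z i ∂P

/-- The covariance matrix. -/
def covMat {ι : Type*} (P : Measure (EuclideanSpace ℝ ι)) : Matrix ι ι ℝ :=
  Matrix.of fun i j => cov[fun z => z i, fun z => z j; P]

/-- The Mahalanobis distance `√((z - m)ᵀ M⁻¹ (z - m))`. -/
def mahalanobis {ι : Type*} [Fintype ι] [DecidableEq ι] (M : Matrix ι ι ℝ)
    (m z : EuclideanSpace ℝ ι) : ℝ :=
  Real.sqrt ((z - m).ofLp ⬝ᵥ M⁻¹.mulVec (z - m).ofLp)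

/-- `g` is elliptically symmetric about `m` with normalized covariance matrix `M`. -/
structure IsEllipticallySymmetric {ι : Type*} [Fintype ι] [DecidableEq ι]
    (g : EuclideanSpace ℝ ι → ℝ) (m : EuclideanSpace ℝ ι) (M : Matrix ι ι ℝ) : Prop where
  posDef : M.PosDef
  trace_eq : M.trace = Fintype.card ι
  eq_of_mahalanobis_eq : ∀ z z', mahalanobis M m z = mahalanobis M m z' → g z = g z'

/-- `g` is positive with `log g` concave on the whole space, and `log g` is strictly concave on
some nonempty open set. (`StrictConcaveOn` asks the set to be convex; this loses nothing, since
every nonempty open set contains an open ball.) -/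
structure SomewhereStrictlyLogConcave {E : Type*} [NormedAddCommGroup E] [NormedSpace ℝ E]
    (g : E → ℝ) : Prop where
  pos : ∀ z, 0 < g z
  concave : ConcaveOn ℝ Set.univ fun z => Real.log (g z)
  strict : ∃ U : Set E, IsOpen U ∧ U.Nonempty ∧ StrictConcaveOn ℝ U fun z => Real.log (g z)

/-- The density `p₀` defined by `g z = p₀ (M^{-1/2} (z - m)) |M|^{-1/2}`, that is,
`p₀ t = g (m + M^{1/2} t) |M|^{1/2}`. -/
def baseDensity {ι : Type*} [Fintype ι] [DecidableEq ι]
    (g : EuclideanSpace ℝ ι → ℝ) (m : EuclideanSpace ℝ ι) (M : Matrix ι ι ℝ)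
    (t : EuclideanSpace ℝ ι) : ℝ :=
  g (m + Matrix.toEuclideanCLM (𝕜 := ℝ) (CFC.sqrt M) t) * Real.sqrt M.det

/-- The function `f` on `[0, ∞)` with `f ‖t‖ = log (p₀ t)` exists and is continuously
differentiable on `[0, ∞)`, with a finite one-sided derivative at `0`. -/
def HasRegularProfile {ι : Type*} [Fintype ι] [DecidableEq ι]
    (g : EuclideanSpace ℝ ι → ℝ) (m : EuclideanSpace ℝ ι) (M : Matrix ι ι ℝ) : Prop :=
  ∃ f : ℝ → ℝ, ContDiffOn ℝ 1 f (Set.Ici 0) ∧ ∀ t, f ‖t‖ = Real.log (baseDensity g m M t)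

/-- The point with coordinates `x` along `σ` and `y` along the remaining coordinates `τ`. -/
def join {σ τ : Type*} (x : EuclideanSpace ℝ σ) (y : EuclideanSpace ℝ τ) :
    EuclideanSpace ℝ (σ ⊕ τ) :=
  WithLp.toLp 2 (Sum.elim x.ofLp y.ofLp)

/-- The marginal density of the coordinates `τ`. -/
def marginalDensity {σ τ : Type*} [Fintype σ]
    (p : EuclideanSpace ℝ (σ ⊕ τ) → ℝ) (y : EuclideanSpace ℝ τ) : ℝ :=
  ∫ x : EuclideanSpace ℝ σ, p (join x y)

/-- The conditional density of the coordinates `σ` given that the coordinates `τ` equal `y`;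
it is meaningful where the marginal density is positive. -/
def condDensity {σ τ : Type*} [Fintype σ]
    (p : EuclideanSpace ℝ (σ ⊕ τ) → ℝ) (y : EuclideanSpace ℝ τ)
    (x : EuclideanSpace ℝ σ) : ℝ :=
  p (join x y) / marginalDensity p y

/-- The reverse divergence `KL(q ‖ p)` of the Gaussian `q` with mean `ν` and covariance `S`. -/
def reverseKL {ι : Type*} [Fintype ι] [DecidableEq ι] (p : EuclideanSpace ℝ ι → ℝ)
    (ν : EuclideanSpace ℝ ι) (S : Matrix ι ι ℝ) : ℝ≥0∞ :=
  klDiv (multivariateGaussian ν S) (densityMeasure p)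

/-- The nondegenerate Gaussian with parameters `ν` and `S` minimizes `KL(q ‖ p)` over all
nondegenerate Gaussians `q`. -/
def IsReverseKLMinimizer {ι : Type*} [Fintype ι] [DecidableEq ι] (p : EuclideanSpace ℝ ι → ℝ)
    (ν : EuclideanSpace ℝ ι) (S : Matrix ι ι ℝ) : Prop :=
  S.PosDef ∧ ∀ (ν' : EuclideanSpace ℝ ι) (S' : Matrix ι ι ℝ), S'.PosDef →
    reverseKL p ν S ≤ reverseKL p ν' S'

end PartialVI

end

/-! Write a Gaussian as the law of `a + B ξ` with `ξ` standard. Up to a constant, `KL(q ‖ p)` is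
then the free energy `-E[K (a + B ξ)] - log |det B|` with `K = log p` (`toReal_reverseKL`). Any
factor `B` of the covariance may be used, and a block upper triangular one is convenient: the
coordinates along `τ` are then driven by `ξ_τ` alone. After whitening along `σ`, almost every
section of `K` along `σ` is radial and concave, and strictly concave on some open set
(`isRadialConcave_whitenedLog`).

The engine is `IsRadialConcave.midpoint`. Averaging two competitors with the same `τ`-part does not
lower the expectation of `K` below the average, so minimality constrains the determinants. Apply
this to a minimizer and its reflection in `σ`, which has the same free energy: their midpoint has no
mean along `σ` and no cross block, and the determinants agree. So concavity must be an equality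
almost everywhere, and strict concavity on the open sets kills both the `σ`-mean and the cross
block. What is left along `σ` is `O * diagonal l` with `O` orthogonal; radiality removes `O`.
Permuting `l` preserves the free energy, while `log` is strictly concave, so `l` is constant and
`S_σσ = c² M`.

The same symmetry gives the moments of `p`: the whitened law is invariant under orthogonal maps
along `σ`, hence has mean zero and second moments `s • 1` there. Therefore `μ_σ = m`, `Σ_σσ = s M`
and `γ = c / √s`. For fixed `τ`-marginal, strict concavity of `log` makes `c` unique. If the
conditional does not depend on `y`, then `K` is a sum `k x + h y` and the `τ`-terms cancel from the
comparison of two scales. -/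

noncomputable section

namespace PartialVI

/-! ### Affine changes of variables. -/

section Affine

variable {ι : Type*} [Fintype ι] [DecidableEq ι]

/-- The affine map `x ↦ a + B x`. -/
def affMap (a : EuclideanSpace ℝ ι) (B : Matrix ι ι ℝ) (x : EuclideanSpace ℝ ι) :
    EuclideanSpace ℝ ι :=
  a + Matrix.toEuclideanCLM (𝕜 := ℝ) B x

lemma ofLp_affMap (a : EuclideanSpace ℝ ι) (B : Matrix ι ι ℝ) (x : EuclideanSpace ℝ ι) :
    (affMap a B x).ofLp = a.ofLp + B.mulVec x.ofLp := rfl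

lemma continuous_affMap (a : EuclideanSpace ℝ ι) (B : Matrix ι ι ℝ) :
    Continuous (affMap a B) := by
  unfold affMap; fun_prop

lemma measurable_affMap (a : EuclideanSpace ℝ ι) (B : Matrix ι ι ℝ) :
    Measurable (affMap a B) := (continuous_affMap a B).measurable

lemma affMap_affMap (a b : EuclideanSpace ℝ ι) (A B : Matrix ι ι ℝ) (x : EuclideanSpace ℝ ι) :
    affMap a A (affMap b B x) = affMap (affMap a A b) (A * B) x := by
  simp [affMap, add_assoc]

lemma affMap_zero_one (x : EuclideanSpace ℝ ι) : affMap 0 1 x = x := by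
  simp [affMap]

lemma exists_affMap_inv (a : EuclideanSpace ℝ ι) {B : Matrix ι ι ℝ} (hB : B.det ≠ 0) :
    (∀ x, affMap (affMap 0 B⁻¹ (-a)) B⁻¹ (affMap a B x) = x) ∧
      ∀ x, affMap a B (affMap (affMap 0 B⁻¹ (-a)) B⁻¹ x) = x := by
  have hu : IsUnit B.det := isUnit_iff_ne_zero.mpr hB
  refine ⟨fun x => ?_, fun x => ?_⟩
  · rw [affMap_affMap, Matrix.nonsing_inv_mul _ hu]
    simp [affMap]
  · rw [affMap_affMap, Matrix.mul_nonsing_inv _ hu]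
    have : affMap a B (affMap 0 B⁻¹ (-a)) = 0 := by
      rw [affMap_affMap, Matrix.mul_nonsing_inv _ hu]; simp [affMap]
    rw [this, affMap_zero_one]

/-- An invertible affine map as a measurable equivalence. -/
def affEquiv (a : EuclideanSpace ℝ ι) (B : Matrix ι ι ℝ) (hB : B.det ≠ 0) :
    EuclideanSpace ℝ ι ≃ᵐ EuclideanSpace ℝ ι where
  toFun := affMap a B
  invFun := affMap (affMap 0 B⁻¹ (-a)) B⁻¹
  left_inv := (exists_affMap_inv a hB).1
  right_inv := (exists_affMap_inv a hB).2
  measurable_toFun := measurable_affMap a B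
  measurable_invFun := measurable_affMap _ _

lemma coe_affEquiv (a : EuclideanSpace ℝ ι) (B : Matrix ι ι ℝ) (hB : B.det ≠ 0) :
    ⇑(affEquiv a B hB) = affMap a B := rfl

lemma map_affMap_volume (a : EuclideanSpace ℝ ι) {B : Matrix ι ι ℝ} (hB : B.det ≠ 0) :
    (volume : Measure (EuclideanSpace ℝ ι)).map (affMap a B) =
      ENNReal.ofReal |B.det|⁻¹ • volume := by
  have hdet : LinearMap.det (Matrix.toEuclideanLin B) = B.det := by
    have h : Matrix.toEuclideanLin B =
        Matrix.toLin (PiLp.basisFun 2 ℝ ι) (PiLp.basisFun 2 ℝ ι) B := by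
      rw [← Matrix.toLpLin_eq_toLin]
    rw [h, LinearMap.det_toLin]
  have h1 : affMap a B = (fun x => a + x) ∘ (Matrix.toEuclideanLin B) := rfl
  rw [h1, ← Measure.map_map (measurable_const_add a)
    (Matrix.toEuclideanLin B).continuous_of_finiteDimensional.measurable,
    Measure.map_linearMap_addHaar_eq_smul_addHaar _ (by rwa [hdet]), Measure.map_smul,
    map_add_left_eq_self, hdet, abs_inv]

lemma quasiMeasurePreserving_affMap (a : EuclideanSpace ℝ ι) {B : Matrix ι ι ℝ}
    (hB : B.det ≠ 0) : Measure.QuasiMeasurePreserving (affMap a B) volume volume := by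
  refine ⟨measurable_affMap a B, ?_⟩
  rw [map_affMap_volume a hB]
  exact Measure.smul_absolutelyContinuous

lemma integrable_comp_affMap (a : EuclideanSpace ℝ ι) {B : Matrix ι ι ℝ} (hB : B.det ≠ 0)
    {f : EuclideanSpace ℝ ι → ℝ} (hf : Integrable f) : Integrable fun x => f (affMap a B x) := by
  have h : Integrable f (volume.map (affMap a B)) := by
    rw [map_affMap_volume a hB]
    exact hf.smul_measure ENNReal.ofReal_ne_top
  exact h.comp_measurable (measurable_affMap a B)

lemma map_withDensity_comp {α β : Type*} [MeasurableSpace α] [MeasurableSpace β]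
    (μ : Measure α) {T : α → β} (hT : Measurable T) {f : β → ℝ≥0∞} (hf : Measurable f) :
    (μ.withDensity fun x => f (T x)).map T = (μ.map T).withDensity f := by
  ext s hs
  rw [Measure.map_apply hT hs, withDensity_apply _ (hT hs), withDensity_apply _ hs,
    setLIntegral_map hs hf hT]

/-- Change of variables: the factor `|det B|` in the density cancels the scaling of Lebesgue
measure. -/
lemma map_affMap_withDensity (a : EuclideanSpace ℝ ι) {B : Matrix ι ι ℝ} (hB : B.det ≠ 0)
    {p : EuclideanSpace ℝ ι → ℝ} (hp : Measurable p) :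
    (volume.withDensity fun x => ENNReal.ofReal (|B.det| * p (affMap a B x))).map (affMap a B) =
      densityMeasure p := by
  have hB' : |B.det| ≠ 0 := abs_ne_zero.mpr hB
  rw [map_withDensity_comp volume (measurable_affMap a B)
    (f := fun z => ENNReal.ofReal (|B.det| * p z)) (by fun_prop), map_affMap_volume a hB,
    withDensity_smul_measure]
  have h2 : (fun z => ENNReal.ofReal (|B.det| * p z)) =
      ENNReal.ofReal |B.det| • fun z => ENNReal.ofReal (p z) := by
    ext z; simp [ENNReal.ofReal_mul]
  rw [h2, withDensity_smul _ (by fun_prop), smul_smul, ← ENNReal.ofReal_mul (by positivity),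
    inv_mul_cancel₀ hB', ENNReal.ofReal_one, one_smul, densityMeasure]

end Affine

/-! ### Gaussian laws as affine images, and the standard density. -/

section Gaussian

variable {ι : Type*} [Fintype ι]

lemma posSemidef_mul_transpose_self (B : Matrix ι ι ℝ) : (B * B.transpose).PosSemidef := by
  simpa using Matrix.posSemidef_self_mul_conjTranspose B

lemma posDef_mul_transpose_self [DecidableEq ι] {B : Matrix ι ι ℝ} (hB : B.det ≠ 0) :
    (B * B.transpose).PosDef := by
  rw [(posSemidef_mul_transpose_self B).posDef_iff_det_ne_zero]
  simp [hB]

/-- Comparison of characteristic functions. `B` need not be the symmetric root, which later permits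
triangular factors. -/
lemma map_affMap_stdGaussian [DecidableEq ι] (a : EuclideanSpace ℝ ι) (B : Matrix ι ι ℝ) :
    (stdGaussian (EuclideanSpace ℝ ι)).map (affMap a B) =
      multivariateGaussian a (B * B.transpose) := by
  have : IsProbabilityMeasure ((stdGaussian (EuclideanSpace ℝ ι)).map (affMap a B)) :=
    Measure.isProbabilityMeasure_map (measurable_affMap a B).aemeasurable
  apply Measure.ext_of_charFun
  ext t
  rw [charFun_multivariateGaussian (posSemidef_mul_transpose_self B), charFun_apply,
    integral_map (measurable_affMap a B).aemeasurable
      (Measurable.aestronglyMeasurable (by fun_prop))]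
  have h1 : ∀ x : EuclideanSpace ℝ ι, inner ℝ (affMap a B x) t =
      inner ℝ t a + inner ℝ x (Matrix.toEuclideanCLM (𝕜 := ℝ) B.transpose t) := by
    intro x
    rw [affMap, inner_add_left, real_inner_comm, real_inner_comm _ (Matrix.toEuclideanCLM (𝕜 := ℝ) B x),
      Matrix.inner_toEuclideanCLM, Matrix.inner_toEuclideanCLM, Matrix.mulVec_transpose,
      Matrix.dotProduct_mulVec, dotProduct_comm]
  simp_rw [h1, Complex.ofReal_add, add_mul, Complex.exp_add]
  rw [integral_const_mul, ← charFun_apply, charFun_stdGaussian, ← Complex.exp_add]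
  congr 1
  have h2 : ‖Matrix.toEuclideanCLM (𝕜 := ℝ) B.transpose t‖ ^ 2 =
      t.ofLp ⬝ᵥ (B * B.transpose).mulVec t.ofLp := by
    rw [← real_inner_self_eq_norm_sq, Matrix.inner_toEuclideanCLM, Matrix.ofLp_toEuclideanCLM,
      ← Matrix.mulVec_mulVec, Matrix.mulVec_transpose, Matrix.dotProduct_mulVec]
  rw [← Complex.ofReal_pow, h2]
  push_cast
  ring

/-- The density of the standard Gaussian measure. -/
def stdDensity (x : EuclideanSpace ℝ ι) : ℝ :=
  (2 * Real.pi) ^ (-(Fintype.card ι : ℝ) / 2) * Real.exp (-‖x‖ ^ 2 / 2)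

lemma stdDensity_pos (x : EuclideanSpace ℝ ι) : 0 < stdDensity x := by
  unfold stdDensity; positivity

lemma measurable_stdDensity : Measurable (stdDensity (ι := ι)) := by
  unfold stdDensity; fun_prop

lemma log_stdDensity (x : EuclideanSpace ℝ ι) : Real.log (stdDensity x) =
    Real.log ((2 * Real.pi) ^ (-(Fintype.card ι : ℝ) / 2)) - ‖x‖ ^ 2 / 2 := by
  rw [stdDensity, Real.log_mul (by positivity) (by positivity), Real.log_exp]; ring

lemma integrable_stdDensity : Integrable (stdDensity (ι := ι)) := by
  have h := (GaussianFourier.integrable_cexp_neg_mul_sq_norm_add (b := 1 / 2) (by norm_num) 0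
    (0 : EuclideanSpace ℝ ι)).norm
  refine (h.const_mul ((2 * Real.pi) ^ (-(Fintype.card ι : ℝ) / 2))).congr (.of_forall fun x => ?_)
  simp only [stdDensity, Complex.norm_exp]
  congr 2
  simp
  rw [← Complex.ofReal_pow, Complex.ofReal_re]; norm_num; ring

lemma stdGaussian_eq_withDensity : stdGaussian (EuclideanSpace ℝ ι) =
    volume.withDensity fun x => ENNReal.ofReal (stdDensity x) := by
  have : IsFiniteMeasure ((volume : Measure (EuclideanSpace ℝ ι)).withDensity
      fun x => ENNReal.ofReal (stdDensity x)) :=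
    isFiniteMeasure_withDensity_ofReal integrable_stdDensity.2
  apply Measure.ext_of_charFun
  ext t
  rw [charFun_stdGaussian, charFun_apply, integral_withDensity_eq_integral_toReal_smul
    measurable_stdDensity.ennreal_ofReal (.of_forall fun x => by simp)]
  have h := GaussianFourier.integral_cexp_neg_mul_sq_norm_add (b := 1 / 2) (by norm_num) Complex.I t
  have h3 : ∀ x : EuclideanSpace ℝ ι, (ENNReal.ofReal (stdDensity x)).toReal •
      Complex.exp (↑(inner ℝ x t) * Complex.I) =
      ((2 * Real.pi) ^ (-(Fintype.card ι : ℝ) / 2) : ℝ) *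
        Complex.exp (-(1 / 2) * ↑‖x‖ ^ 2 + Complex.I * ↑(inner ℝ t x)) := by
    intro x
    rw [ENNReal.toReal_ofReal (stdDensity_pos x).le, stdDensity, Complex.exp_add,
      Complex.real_smul, real_inner_comm]
    push_cast
    rw [mul_assoc]
    congr 3 <;> ring
  simp_rw [h3]
  rw [integral_const_mul, h, finrank_euclideanSpace, ← mul_assoc]
  have h4 : (((2 * Real.pi) ^ (-(Fintype.card ι : ℝ) / 2) : ℝ) : ℂ) *
      (↑Real.pi / (1 / 2)) ^ ((Fintype.card ι : ℂ) / 2) = 1 := by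
    have : (↑Real.pi / (1 / 2) : ℂ) = ((2 * Real.pi : ℝ) : ℂ) := by push_cast; ring
    rw [this, show ((Fintype.card ι : ℂ) / 2) = (((Fintype.card ι : ℝ) / 2 : ℝ) : ℂ) by push_cast; rfl,
      ← Complex.ofReal_cpow (by positivity), ← Complex.ofReal_mul,
      ← Real.rpow_add (by positivity)]
    rw [neg_div, neg_add_cancel, Real.rpow_zero, Complex.ofReal_one]
  rw [h4, one_mul, Complex.I_sq]
  congr 1; ring

lemma stdGaussian_absolutelyContinuous : stdGaussian (EuclideanSpace ℝ ι) ≪ volume := by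
  rw [stdGaussian_eq_withDensity]; exact withDensity_absolutelyContinuous _ _

lemma absolutelyContinuous_stdGaussian :
    (volume : Measure (EuclideanSpace ℝ ι)) ≪ stdGaussian (EuclideanSpace ℝ ι) := by
  rw [stdGaussian_eq_withDensity]
  refine withDensity_absolutelyContinuous' (measurable_stdDensity.ennreal_ofReal.aemeasurable)
    (.of_forall fun x => ?_)
  simp [stdDensity_pos x]

lemma integrable_log_stdDensity :
    Integrable (fun x => Real.log (stdDensity x)) (stdGaussian (EuclideanSpace ℝ ι)) := by
  simp_rw [log_stdDensity]
  refine (integrable_const _).sub (Integrable.div_const ?_ 2)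
  exact (IsGaussian.memLp_two_id (μ := stdGaussian (EuclideanSpace ℝ ι))).integrable_norm_pow
    two_ne_zero

/-- The Gaussian weight cancels the denominator. This supplies the integrable upper bound for `K` in
`IsRadialConcave.integrable_of_le`. -/
lemma integrable_div_stdDensity {f : EuclideanSpace ℝ ι → ℝ} (hf : Integrable f) :
    Integrable (fun x => f x / stdDensity x) (stdGaussian (EuclideanSpace ℝ ι)) := by
  rw [stdGaussian_eq_withDensity, integrable_withDensity_iff_integrable_smul'
    measurable_stdDensity.ennreal_ofReal (.of_forall fun x => by simp)]
  refine hf.congr (.of_forall fun x => ?_)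
  simp only [smul_eq_mul]
  rw [ENNReal.toReal_ofReal (stdDensity_pos x).le, mul_div_cancel₀ _ (stdDensity_pos x).ne']

lemma measurePreserving_stdGaussian [DecidableEq ι] {O : Matrix ι ι ℝ} (hO : O * O.transpose = 1) :
    MeasurePreserving (affMap 0 O) (stdGaussian (EuclideanSpace ℝ ι))
      (stdGaussian (EuclideanSpace ℝ ι)) := by
  refine ⟨measurable_affMap 0 O, ?_⟩
  rw [map_affMap_stdGaussian, hO, multivariateGaussian_zero_one]

end Gaussian

/-! ### From reverse KL to free energy. -/

section Divergence

/-- Data processing inequality, applied to the map and to its inverse. -/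
lemma klDiv_map_measurableEquiv {α β : Type*} [MeasurableSpace α] [MeasurableSpace β]
    (e : α ≃ᵐ β) (μ ν : Measure α) [IsFiniteMeasure μ] [IsFiniteMeasure ν] :
    klDiv (μ.map e) (ν.map e) = klDiv μ ν := by
  refine le_antisymm (klDiv_map_le _ _ e.measurable) ?_
  have := klDiv_map_le (μ.map e) (ν.map e) e.symm.measurable
  simpa [Measure.map_map e.symm.measurable e.measurable] using this

variable {ι : Type*} [Fintype ι]

lemma IsProbDensity.integrable {p : EuclideanSpace ℝ ι → ℝ} (hp : IsProbDensity p) :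
    Integrable p :=
  not_imp_comm.1 integral_undef (by rw [hp.integral_eq_one]; exact one_ne_zero)

lemma IsProbDensity.isProbabilityMeasure {p : EuclideanSpace ℝ ι → ℝ} (hp : IsProbDensity p) :
    IsProbabilityMeasure (densityMeasure p) := by
  refine ⟨?_⟩
  rw [densityMeasure, withDensity_apply _ MeasurableSet.univ, Measure.restrict_univ,
    ← ofReal_integral_eq_lintegral_ofReal hp.integrable (.of_forall hp.nonneg),
    hp.integral_eq_one, ENNReal.ofReal_one]

variable [DecidableEq ι]

/-- The density of `P` pulled back along `x ↦ a + B x`, as a measure. -/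
def pullbackMeasure (p : EuclideanSpace ℝ ι → ℝ) (a : EuclideanSpace ℝ ι) (B : Matrix ι ι ℝ) :
    Measure (EuclideanSpace ℝ ι) :=
  volume.withDensity fun x => ENNReal.ofReal (|B.det| * p (affMap a B x))

lemma IsProbDensity.isProbabilityMeasure_pullback {p : EuclideanSpace ℝ ι → ℝ}
    (hp : IsProbDensity p) (a : EuclideanSpace ℝ ι) {B : Matrix ι ι ℝ} (hB : B.det ≠ 0) :
    IsProbabilityMeasure (pullbackMeasure p a B) := by
  have := hp.isProbabilityMeasure
  rw [← map_affMap_withDensity a hB hp.measurable] at this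
  have : IsProbabilityMeasure ((pullbackMeasure p a B).map (affMap a B)) := this
  exact Measure.isProbabilityMeasure_of_map (affMap a B)

/-- Both arguments are pulled back by the same affine bijection, so the dependence on `q` moves
entirely into the second one. -/
lemma reverseKL_mul_transpose {p : EuclideanSpace ℝ ι → ℝ}
    (hp : IsProbDensity p) (a : EuclideanSpace ℝ ι) {B : Matrix ι ι ℝ} (hB : B.det ≠ 0) :
    reverseKL p a (B * B.transpose) =
      klDiv (stdGaussian (EuclideanSpace ℝ ι)) (pullbackMeasure p a B) := by
  have := hp.isProbabilityMeasure_pullback a hB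
  rw [reverseKL, ← map_affMap_stdGaussian, ← map_affMap_withDensity a hB hp.measurable,
    ← coe_affEquiv a B hB]
  exact klDiv_map_measurableEquiv (affEquiv a B hB) _ (pullbackMeasure p a B)

/-- Finite divergence forces `q ≪ p`, and a nondegenerate Gaussian has the same null sets as
Lebesgue measure. -/
lemma ae_pos_of_reverseKL_ne_top {p : EuclideanSpace ℝ ι → ℝ}
    (hp : IsProbDensity p) (a : EuclideanSpace ℝ ι) {B : Matrix ι ι ℝ} (hB : B.det ≠ 0)
    (h : reverseKL p a (B * B.transpose) ≠ ∞) : ∀ᵐ z, 0 < p z := by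
  rw [reverseKL_mul_transpose hp a hB, klDiv_ne_top_iff] at h
  have h1 : ∀ᵐ x ∂(pullbackMeasure p a B), p (affMap a B x) ≠ 0 := by
    have hm : Measurable fun x => ENNReal.ofReal (|B.det| * p (affMap a B x)) :=
      ((hp.measurable.comp (measurable_affMap a B)).const_mul _).ennreal_ofReal
    rw [pullbackMeasure, ae_withDensity_iff hm]
    refine .of_forall fun x hx h0 => hx ?_
    simp [h0]
  have h2 := absolutelyContinuous_stdGaussian.ae_le (h.1.ae_le h1)
  have hB' : (B⁻¹).det ≠ 0 := by
    rw [Matrix.det_nonsing_inv, Ring.inverse_eq_inv']; exact inv_ne_zero hB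
  have h3 := (quasiMeasurePreserving_affMap (affMap 0 B⁻¹ (-a)) hB').ae h2
  filter_upwards [h3] with z hz
  rw [(exists_affMap_inv a hB).2] at hz
  exact (hp.nonneg z).lt_of_ne' hz

lemma llr_stdGaussian_pullback {p : EuclideanSpace ℝ ι → ℝ}
    (hp : IsProbDensity p) (hpos : ∀ᵐ z, 0 < p z) (a : EuclideanSpace ℝ ι) {B : Matrix ι ι ℝ}
    (hB : B.det ≠ 0) :
    stdGaussian (EuclideanSpace ℝ ι) ≪ pullbackMeasure p a B ∧
      llr (stdGaussian (EuclideanSpace ℝ ι)) (pullbackMeasure p a B)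
        =ᵐ[stdGaussian (EuclideanSpace ℝ ι)] fun x =>
          Real.log (stdDensity x) - Real.log |B.det| - Real.log (p (affMap a B x)) := by
  have := hp.isProbabilityMeasure_pullback a hB
  set f : EuclideanSpace ℝ ι → ℝ := fun x => |B.det| * p (affMap a B x) with hf
  have hfm : Measurable f := (hp.measurable.comp (measurable_affMap a B)).const_mul _
  have hp' : ∀ᵐ x, 0 < p (affMap a B x) := (quasiMeasurePreserving_affMap a hB).ae hpos
  have hgm : Measurable fun x => ENNReal.ofReal (stdDensity x / f x) :=
    (measurable_stdDensity.div hfm).ennreal_ofReal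
  have h1 : stdGaussian (EuclideanSpace ℝ ι) =
      (pullbackMeasure p a B).withDensity fun x => ENNReal.ofReal (stdDensity x / f x) := by
    rw [pullbackMeasure, ← withDensity_mul _ hfm.ennreal_ofReal hgm, stdGaussian_eq_withDensity]
    refine withDensity_congr_ae ?_
    filter_upwards [hp'] with x hx
    have hfx : 0 < f x := mul_pos (abs_pos.mpr hB) hx
    rw [Pi.mul_apply, ← ENNReal.ofReal_mul hfx.le, mul_div_cancel₀ _ hfx.ne']
  have hac : stdGaussian (EuclideanSpace ℝ ι) ≪ pullbackMeasure p a B := by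
    rw [h1]; exact withDensity_absolutelyContinuous _ _
  refine ⟨hac, ?_⟩
  have h2 : (stdGaussian (EuclideanSpace ℝ ι)).rnDeriv (pullbackMeasure p a B)
      =ᵐ[stdGaussian (EuclideanSpace ℝ ι)] fun x => ENNReal.ofReal (stdDensity x / f x) := by
    have h3 := Measure.rnDeriv_withDensity (pullbackMeasure p a B) hgm
    rw [← h1] at h3
    exact hac.ae_le h3
  filter_upwards [h2, stdGaussian_absolutelyContinuous.ae_le hp'] with x hx hpx
  have hfx : 0 < f x := mul_pos (abs_pos.mpr hB) hpx
  rw [llr, hx, ENNReal.toReal_ofReal (div_pos (stdDensity_pos x) hfx).le,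
    Real.log_div (stdDensity_pos x).ne' hfx.ne', hf,
    Real.log_mul (abs_pos.mpr hB).ne' hpx.ne']
  ring

/-- The part of `KL(q ‖ p)` that depends on `q`, for `q` the law of `a + B ξ` with `ξ` standard
Gaussian and `K = log p`. -/
def freeEnergy (K : EuclideanSpace ℝ ι → ℝ) (a : EuclideanSpace ℝ ι) (B : Matrix ι ι ℝ) : ℝ :=
  -(∫ x, K (affMap a B x) ∂stdGaussian (EuclideanSpace ℝ ι)) - Real.log |B.det|

/-- The law of `a + B ξ` has minimal free energy among nondegenerate Gaussians. -/
structure MinimizesFreeEnergy (K : EuclideanSpace ℝ ι → ℝ) (a : EuclideanSpace ℝ ι)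
    (B : Matrix ι ι ℝ) : Prop where
  integrable : Integrable (fun x => K (affMap a B x)) (stdGaussian (EuclideanSpace ℝ ι))
  le : ∀ (a' : EuclideanSpace ℝ ι) (B' : Matrix ι ι ℝ), B'.det ≠ 0 →
    Integrable (fun x => K (affMap a' B' x)) (stdGaussian (EuclideanSpace ℝ ι)) →
      freeEnergy K a B ≤ freeEnergy K a' B'

/-- In the log-likelihood ratio every term other than `log p` is integrable under the Gaussian. -/
lemma reverseKL_ne_top_iff {p : EuclideanSpace ℝ ι → ℝ}
    (hp : IsProbDensity p) (hpos : ∀ᵐ z, 0 < p z) (a : EuclideanSpace ℝ ι) {B : Matrix ι ι ℝ}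
    (hB : B.det ≠ 0) :
    reverseKL p a (B * B.transpose) ≠ ∞ ↔ Integrable (fun x => Real.log (p (affMap a B x)))
      (stdGaussian (EuclideanSpace ℝ ι)) := by
  obtain ⟨hac, hllr⟩ := llr_stdGaussian_pullback hp hpos a hB
  rw [reverseKL_mul_transpose hp a hB, klDiv_ne_top_iff, integrable_congr hllr]
  have h0 : Integrable (fun x => Real.log (stdDensity x) - Real.log |B.det|)
      (stdGaussian (EuclideanSpace ℝ ι)) := integrable_log_stdDensity.sub (integrable_const _)
  refine ⟨fun h => ?_, fun h => ⟨hac, h0.sub h⟩⟩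
  refine (h0.sub h.2).congr (.of_forall fun x => ?_)
  simp

lemma toReal_reverseKL {p : EuclideanSpace ℝ ι → ℝ}
    (hp : IsProbDensity p) (hpos : ∀ᵐ z, 0 < p z) (a : EuclideanSpace ℝ ι) {B : Matrix ι ι ℝ}
    (hB : B.det ≠ 0) (hint : Integrable (fun x => Real.log (p (affMap a B x)))
      (stdGaussian (EuclideanSpace ℝ ι))) :
    (reverseKL p a (B * B.transpose)).toReal =
      ∫ x, Real.log (stdDensity x) ∂stdGaussian (EuclideanSpace ℝ ι) +
        freeEnergy (fun z => Real.log (p z)) a B := by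
  obtain ⟨hac, hllr⟩ := llr_stdGaussian_pullback hp hpos a hB
  have := hp.isProbabilityMeasure_pullback a hB
  have h0 : Integrable (fun x => Real.log (stdDensity x) - Real.log |B.det|)
      (stdGaussian (EuclideanSpace ℝ ι)) := integrable_log_stdDensity.sub (integrable_const _)
  rw [reverseKL_mul_transpose hp a hB, toReal_klDiv_of_measure_eq hac (by simp),
    integral_congr_ae hllr, integral_sub h0 hint,
    integral_sub integrable_log_stdDensity (integrable_const _), freeEnergy]
  simp
  ring

lemma isUnit_det_sqrt {S : Matrix ι ι ℝ} (hS : S.PosDef) : (CFC.sqrt S).det ≠ 0 := by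
  intro h
  have h2 := congrArg Matrix.det (CFC.sqrt_mul_sqrt_self S hS.posSemidef.nonneg)
  rw [Matrix.det_mul, h, zero_mul] at h2
  exact hS.det_pos.ne h2

lemma transpose_sqrt (S : Matrix ι ι ℝ) : (CFC.sqrt S).transpose = CFC.sqrt S := by
  simpa using (Matrix.nonneg_iff_posSemidef.1 (CFC.sqrt_nonneg S)).isHermitian.eq

lemma sqrt_mul_transpose {S : Matrix ι ι ℝ} (hS : S.PosDef) :
    CFC.sqrt S * (CFC.sqrt S).transpose = S := by
  rw [transpose_sqrt, CFC.sqrt_mul_sqrt_self S hS.posSemidef.nonneg]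

lemma ae_pos_of_exists_reverseKL_ne_top {p : EuclideanSpace ℝ ι → ℝ} (hp : IsProbDensity p)
    (hfin : ∃ (ν : EuclideanSpace ℝ ι) (S : Matrix ι ι ℝ), S.PosDef ∧ reverseKL p ν S ≠ ∞) :
    ∀ᵐ z, 0 < p z := by
  obtain ⟨ν, S, hS, h⟩ := hfin
  rw [← sqrt_mul_transpose hS] at h
  exact ae_pos_of_reverseKL_ne_top hp ν (isUnit_det_sqrt hS) h

lemma IsReverseKLMinimizer.minimizesFreeEnergy {p : EuclideanSpace ℝ ι → ℝ}
    (hp : IsProbDensity p)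
    (hfin : ∃ (ν : EuclideanSpace ℝ ι) (S : Matrix ι ι ℝ), S.PosDef ∧ reverseKL p ν S ≠ ∞)
    {ν : EuclideanSpace ℝ ι} {B : Matrix ι ι ℝ} (hB : B.det ≠ 0)
    (h : IsReverseKLMinimizer p ν (B * B.transpose)) :
    MinimizesFreeEnergy (fun z => Real.log (p z)) ν B := by
  have hpos := ae_pos_of_exists_reverseKL_ne_top hp hfin
  have hne : reverseKL p ν (B * B.transpose) ≠ ∞ := by
    obtain ⟨ν', S', hS', h'⟩ := hfin
    exact ne_top_of_le_ne_top h' (h.2 ν' S' hS')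
  have hint := (reverseKL_ne_top_iff hp hpos ν hB).1 hne
  refine ⟨hint, fun a' B' hB' hint' => ?_⟩
  have hle := h.2 a' _ (posDef_mul_transpose_self hB')
  have hle' := ENNReal.toReal_mono ((reverseKL_ne_top_iff hp hpos a' hB').2 hint') hle
  rw [toReal_reverseKL hp hpos ν hB hint, toReal_reverseKL hp hpos a' hB' hint'] at hle'
  linarith

/-- An affine change of coordinates shifts all free energies by the same constant `log |det N|`. -/
lemma MinimizesFreeEnergy.comp_affMap {K : EuclideanSpace ℝ ι → ℝ} {c a : EuclideanSpace ℝ ι}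
    {N B : Matrix ι ι ℝ} (hN : N.det ≠ 0) (hB : B.det ≠ 0)
    (h : MinimizesFreeEnergy K (affMap c N a) (N * B)) :
    MinimizesFreeEnergy (fun z => K (affMap c N z)) a B := by
  have key : ∀ (a' : EuclideanSpace ℝ ι) (B' : Matrix ι ι ℝ), B'.det ≠ 0 →
      freeEnergy K (affMap c N a') (N * B') =
        freeEnergy (fun z => K (affMap c N z)) a' B' - Real.log |N.det| := by
    intro a' B' hB'
    simp only [freeEnergy, affMap_affMap, Matrix.det_mul, abs_mul]
    rw [Real.log_mul (abs_pos.mpr hN).ne' (abs_pos.mpr hB').ne']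
    ring
  refine ⟨?_, fun a' B' hB' hint => ?_⟩
  · simp only [affMap_affMap]; exact h.integrable
  · simp only [affMap_affMap] at hint
    have := h.le _ (N * B') (by simp [hN, hB']) hint
    rw [key a B hB, key a' B' hB'] at this
    linarith

end Divergence

/-! ### Sections along `σ`, and the midpoint inequality. -/

section Join

variable {σ τ : Type*}

/-- The coordinates along `σ`. -/
def fstPart (z : EuclideanSpace ℝ (σ ⊕ τ)) : EuclideanSpace ℝ σ :=
  WithLp.toLp 2 fun i => z (Sum.inl i)

/-- The coordinates along `τ`. -/
def sndPart (z : EuclideanSpace ℝ (σ ⊕ τ)) : EuclideanSpace ℝ τ :=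
  WithLp.toLp 2 fun j => z (Sum.inr j)

lemma join_fstPart_sndPart (z : EuclideanSpace ℝ (σ ⊕ τ)) :
    join (fstPart z) (sndPart z) = z := by
  ext i; rcases i with i | i <;> rfl

lemma fstPart_join (x : EuclideanSpace ℝ σ) (y : EuclideanSpace ℝ τ) :
    fstPart (join x y) = x := rfl

lemma sndPart_join (x : EuclideanSpace ℝ σ) (y : EuclideanSpace ℝ τ) :
    sndPart (join x y) = y := rfl

lemma eq_of_parts {z w : EuclideanSpace ℝ (σ ⊕ τ)} (h1 : fstPart z = fstPart w)
    (h2 : sndPart z = sndPart w) : z = w := by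
  rw [← join_fstPart_sndPart z, h1, h2, join_fstPart_sndPart]

lemma measurable_sndPart : Measurable (sndPart : EuclideanSpace ℝ (σ ⊕ τ) → _) := by
  unfold sndPart; fun_prop

variable [Fintype σ] [Fintype τ]

/-- The `τ`-coordinate is put first so that Fubini yields statements for almost every `y`, then
almost every `x`. -/
lemma measurePreserving_join :
    MeasurePreserving (fun q : EuclideanSpace ℝ τ × EuclideanSpace ℝ σ => join q.2 q.1)
      volume volume := by
  have h1 : MeasurePreserving (Prod.map (@WithLp.ofLp 2 (σ → ℝ)) (@WithLp.ofLp 2 (τ → ℝ)))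
      (volume.prod volume) (volume.prod volume) :=
    (PiLp.volume_preserving_ofLp σ).prod (PiLp.volume_preserving_ofLp τ)
  have h2 : MeasurePreserving (Prod.swap : EuclideanSpace ℝ τ × EuclideanSpace ℝ σ → _)
      (volume.prod volume) (volume.prod volume) := Measure.measurePreserving_swap
  exact (PiLp.volume_preserving_toLp (σ ⊕ τ)).comp
    ((volume_measurePreserving_sumPiEquivProdPi_symm (fun _ : σ ⊕ τ => ℝ)).comp (h1.comp h2))

lemma quasiMeasurePreserving_sndPart :
    Measure.QuasiMeasurePreserving (sndPart : EuclideanSpace ℝ (σ ⊕ τ) → EuclideanSpace ℝ τ)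
      volume volume := by
  refine ⟨measurable_sndPart, ?_⟩
  rw [← (measurePreserving_join (σ := σ) (τ := τ)).map_eq,
    Measure.map_map measurable_sndPart measurePreserving_join.measurable]
  exact Measure.quasiMeasurePreserving_fst.absolutelyContinuous

lemma ae_sndPart {P : EuclideanSpace ℝ τ → Prop} (h : ∀ᵐ y, P y) :
    ∀ᵐ z : EuclideanSpace ℝ (σ ⊕ τ), P (sndPart z) :=
  quasiMeasurePreserving_sndPart.ae h

lemma ae_ae_join {P : EuclideanSpace ℝ (σ ⊕ τ) → Prop} (h : ∀ᵐ z, P z) :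
    ∀ᵐ y : EuclideanSpace ℝ τ, ∀ᵐ x : EuclideanSpace ℝ σ, P (join x y) :=
  Measure.ae_ae_of_ae_prod (measurePreserving_join.quasiMeasurePreserving.ae h)

variable [DecidableEq σ] [DecidableEq τ]

lemma fstPart_affMap (a : EuclideanSpace ℝ (σ ⊕ τ)) (C : Matrix σ σ ℝ) (A : Matrix σ τ ℝ)
    (A' : Matrix τ σ ℝ) (D : Matrix τ τ ℝ) (z : EuclideanSpace ℝ (σ ⊕ τ)) :
    fstPart (affMap a (Matrix.fromBlocks C A A' D) z) =
      fstPart a + WithLp.toLp 2 (C.mulVec (fstPart z).ofLp + A.mulVec (sndPart z).ofLp) := by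
  ext i
  change (affMap a _ z).ofLp (Sum.inl i) = _
  rw [ofLp_affMap, Pi.add_apply, Matrix.fromBlocks_mulVec]
  rfl

lemma sndPart_affMap (a : EuclideanSpace ℝ (σ ⊕ τ)) (C : Matrix σ σ ℝ) (A : Matrix σ τ ℝ)
    (A' : Matrix τ σ ℝ) (D : Matrix τ τ ℝ) (z : EuclideanSpace ℝ (σ ⊕ τ)) :
    sndPart (affMap a (Matrix.fromBlocks C A A' D) z) =
      sndPart a + WithLp.toLp 2 (A'.mulVec (fstPart z).ofLp + D.mulVec (sndPart z).ofLp) := by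
  ext i
  change (affMap a _ z).ofLp (Sum.inr i) = _
  rw [ofLp_affMap, Pi.add_apply, Matrix.fromBlocks_mulVec]
  rfl

lemma fstPart_affMap_orthogonal (O : Matrix σ σ ℝ) (z : EuclideanSpace ℝ (σ ⊕ τ)) :
    fstPart (affMap 0 (Matrix.fromBlocks O 0 0 1) z) =
      WithLp.toLp 2 (O.mulVec (fstPart z).ofLp) := by
  rw [fstPart_affMap, Matrix.zero_mulVec, add_zero]
  exact zero_add _

lemma sndPart_affMap_orthogonal (O : Matrix σ σ ℝ) (z : EuclideanSpace ℝ (σ ⊕ τ)) :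
    sndPart (affMap 0 (Matrix.fromBlocks O 0 0 1) z) = sndPart z := by
  rw [sndPart_affMap, Matrix.zero_mulVec, zero_add, Matrix.one_mulVec]
  exact zero_add _

/-- A function on the joint space whose sections along `σ` are radial, concave, and somewhere
strictly concave, with integrable exponential. -/
structure IsRadialConcave (K : EuclideanSpace ℝ (σ ⊕ τ) → ℝ) : Prop where
  measurable : Measurable K
  integrable_exp : Integrable fun z => Real.exp (K z)
  radial : ∀ᵐ y : EuclideanSpace ℝ τ, ∀ x x' : EuclideanSpace ℝ σ, ‖x‖ = ‖x'‖ →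
    K (join x y) = K (join x' y)
  concave : ∀ᵐ y : EuclideanSpace ℝ τ, ConcaveOn ℝ Set.univ fun x : EuclideanSpace ℝ σ =>
    K (join x y)
  strict : ∀ᵐ y : EuclideanSpace ℝ τ, ∃ U : Set (EuclideanSpace ℝ σ), IsOpen U ∧ U.Nonempty ∧
    StrictConcaveOn ℝ U fun x => K (join x y)

variable {K : EuclideanSpace ℝ (σ ⊕ τ) → ℝ}

/-- The upper bound for integrability comes from `log t ≤ t`. -/
lemma IsRadialConcave.integrable_of_le (hK : IsRadialConcave K) {a : EuclideanSpace ℝ (σ ⊕ τ)}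
    {B : Matrix (σ ⊕ τ) (σ ⊕ τ) ℝ} (hB : B.det ≠ 0) {g : EuclideanSpace ℝ (σ ⊕ τ) → ℝ}
    (hg : Integrable g (stdGaussian (EuclideanSpace ℝ (σ ⊕ τ))))
    (hle : ∀ᵐ z, g z ≤ K (affMap a B z)) :
    Integrable (fun z => K (affMap a B z)) (stdGaussian (EuclideanSpace ℝ (σ ⊕ τ))) := by
  have h1 := (integrable_div_stdDensity
    (integrable_comp_affMap a hB hK.integrable_exp)).add integrable_log_stdDensity
  refine integrable_of_le_of_le
    (hK.measurable.comp (measurable_affMap a B)).aestronglyMeasurable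
    (stdGaussian_absolutelyContinuous.ae_le hle) (.of_forall fun z => ?_) hg h1
  -- `t + 1 ≤ exp t` at `t = K - log φ`, with `φ` the Gaussian density, bounds `K` by `exp K / φ +
  -- log φ`.
  have h2 := Real.add_one_le_exp (K (affMap a B z) - Real.log (stdDensity z))
  rw [Real.exp_sub, Real.exp_log (stdDensity_pos z)] at h2
  simp only [Pi.add_apply]
  linarith

/-- Both competitors have the same `τ`-part at each `z`, so concavity along `σ` alone bounds `K` at
the midpoint from below by the average. Minimality against the midpoint then bounds its log
determinant from above; in the equality case the integrals agree, and hence the integrands almost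
everywhere. -/
lemma IsRadialConcave.midpoint (hK : IsRadialConcave K) {a₁ a₂ : EuclideanSpace ℝ (σ ⊕ τ)}
    {B₁ B₂ : Matrix (σ ⊕ τ) (σ ⊕ τ) ℝ} (h₁ : MinimizesFreeEnergy K a₁ B₁) (hB₁ : B₁.det ≠ 0)
    (hint₂ : Integrable (fun z => K (affMap a₂ B₂ z))
      (stdGaussian (EuclideanSpace ℝ (σ ⊕ τ))))
    (h₂ : freeEnergy K a₂ B₂ ≤ freeEnergy K a₁ B₁)
    (hsnd : ∀ z, sndPart (affMap a₁ B₁ z) = sndPart (affMap a₂ B₂ z))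
    (hB : ((1 / 2 : ℝ) • (B₁ + B₂)).det ≠ 0) :
    Real.log |((1 / 2 : ℝ) • (B₁ + B₂)).det| ≤ (Real.log |B₁.det| + Real.log |B₂.det|) / 2 ∧
    (Real.log |((1 / 2 : ℝ) • (B₁ + B₂)).det| = (Real.log |B₁.det| + Real.log |B₂.det|) / 2 →
      ∀ᵐ z, K (affMap ((1 / 2 : ℝ) • (a₁ + a₂)) ((1 / 2 : ℝ) • (B₁ + B₂)) z) =
        (K (affMap a₁ B₁ z) + K (affMap a₂ B₂ z)) / 2) := by
  set a := (1 / 2 : ℝ) • (a₁ + a₂) with ha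
  set B := (1 / 2 : ℝ) • (B₁ + B₂) with hBdef
  have hmid : ∀ z, affMap a B z = (1 / 2 : ℝ) • (affMap a₁ B₁ z + affMap a₂ B₂ z) := by
    intro z
    simp only [affMap, ha, hBdef, map_smul, map_add, smul_apply,
      add_apply, smul_add]
    abel
  have hle : ∀ᵐ z, (K (affMap a₁ B₁ z) + K (affMap a₂ B₂ z)) / 2 ≤ K (affMap a B z) := by
    have hc := (quasiMeasurePreserving_affMap a₁ hB₁).ae (ae_sndPart (σ := σ) hK.concave)
    filter_upwards [hc] with z hz
    have h := hz.2 (Set.mem_univ (fstPart (affMap a₁ B₁ z)))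
      (Set.mem_univ (fstPart (affMap a₂ B₂ z))) (by norm_num : (0 : ℝ) ≤ 1 / 2)
      (by norm_num : (0 : ℝ) ≤ 1 / 2) (by norm_num)
    have e1 : join (fstPart (affMap a₁ B₁ z)) (sndPart (affMap a₁ B₁ z)) = affMap a₁ B₁ z :=
      join_fstPart_sndPart _
    have e2 : join (fstPart (affMap a₂ B₂ z)) (sndPart (affMap a₁ B₁ z)) = affMap a₂ B₂ z := by
      rw [hsnd, join_fstPart_sndPart]
    have e3 : join ((1 / 2 : ℝ) • fstPart (affMap a₁ B₁ z) +
        (1 / 2 : ℝ) • fstPart (affMap a₂ B₂ z)) (sndPart (affMap a₁ B₁ z)) = affMap a B z := by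
      rw [hmid]
      refine eq_of_parts ?_ ?_
      · rw [fstPart_join, ← smul_add]; rfl
      · rw [sndPart_join]
        have : sndPart ((1 / 2 : ℝ) • (affMap a₁ B₁ z + affMap a₂ B₂ z)) =
          (1 / 2 : ℝ) • (sndPart (affMap a₁ B₁ z) + sndPart (affMap a₂ B₂ z)) := rfl
        rw [this, ← hsnd, ← two_smul ℝ, smul_smul]; norm_num
    simp only [e1, e2, e3, smul_eq_mul] at h
    linarith
  have hg : Integrable (fun z => (K (affMap a₁ B₁ z) + K (affMap a₂ B₂ z)) / 2)
      (stdGaussian (EuclideanSpace ℝ (σ ⊕ τ))) := (h₁.integrable.add hint₂).div_const 2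
  have hint := hK.integrable_of_le hB hg hle
  have hle' := stdGaussian_absolutelyContinuous.ae_le hle
  have hmin := h₁.le a B hB hint
  have hI : ∫ z, (K (affMap a₁ B₁ z) + K (affMap a₂ B₂ z)) / 2
      ∂(stdGaussian (EuclideanSpace ℝ (σ ⊕ τ))) =
      (∫ z, K (affMap a₁ B₁ z) ∂(stdGaussian (EuclideanSpace ℝ (σ ⊕ τ))) +
        ∫ z, K (affMap a₂ B₂ z) ∂(stdGaussian (EuclideanSpace ℝ (σ ⊕ τ)))) / 2 := by
    rw [integral_div, integral_add h₁.integrable hint₂]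
  have hmono := integral_mono_ae hg hint hle'
  simp only [freeEnergy] at hmin h₂
  refine ⟨by linarith, fun heq => ?_⟩
  have h3 := (integral_eq_iff_of_ae_le hg hint hle').1 (by linarith)
  filter_upwards [absolutelyContinuous_stdGaussian.ae_le h3] with z hz using hz.symm

/-- If the law of `a' + B' ξ` is obtained from that of `a + B ξ` by orthogonal maps along `σ`, it
has the same potential energy. -/
lemma IsRadialConcave.integral_eq_of_norm_eq (hK : IsRadialConcave K)
    {a a' : EuclideanSpace ℝ (σ ⊕ τ)} {B B' : Matrix (σ ⊕ τ) (σ ⊕ τ) ℝ} (hB' : B'.det ≠ 0)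
    {O : Matrix σ σ ℝ} (hO : O * O.transpose = 1)
    (hfst : ∀ z, ‖fstPart (affMap a' B' z)‖ =
      ‖fstPart (affMap a B (affMap 0 (Matrix.fromBlocks O 0 0 1) z))‖)
    (hsnd : ∀ z, sndPart (affMap a' B' z) =
      sndPart (affMap a B (affMap 0 (Matrix.fromBlocks O 0 0 1) z)))
    (hint : Integrable (fun z => K (affMap a B z)) (stdGaussian (EuclideanSpace ℝ (σ ⊕ τ)))) :
    Integrable (fun z => K (affMap a' B' z)) (stdGaussian (EuclideanSpace ℝ (σ ⊕ τ))) ∧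
    ∫ z, K (affMap a' B' z) ∂(stdGaussian (EuclideanSpace ℝ (σ ⊕ τ))) =
      ∫ z, K (affMap a B z) ∂(stdGaussian (EuclideanSpace ℝ (σ ⊕ τ))) := by
  -- Two symmetries are used: the Gaussian is invariant under `O` acting on the input, and by
  -- radiality only the norm of the output along `σ` matters.
  have hmp := measurePreserving_stdGaussian (ι := σ ⊕ τ) (O := Matrix.fromBlocks O 0 0 1)
    (by simp [Matrix.fromBlocks_transpose, Matrix.fromBlocks_multiply, hO])
  have hae : (fun z => K (affMap a' B' z)) =ᵐ[stdGaussian (EuclideanSpace ℝ (σ ⊕ τ))]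
      fun z => K (affMap a B (affMap 0 (Matrix.fromBlocks O 0 0 1) z)) := by
    refine stdGaussian_absolutelyContinuous.ae_le ?_
    filter_upwards [(quasiMeasurePreserving_affMap a' hB').ae (ae_sndPart (σ := σ) hK.radial)]
      with z hz
    have := hz _ _ (hfst z)
    rwa [join_fstPart_sndPart, hsnd, join_fstPart_sndPart] at this
  refine ⟨(integrable_congr hae).2 (hmp.integrable_comp_of_integrable hint), ?_⟩
  rw [integral_congr_ae hae]
  conv_rhs => rw [← hmp.map_eq]
  exact (integral_map (f := fun z => K (affMap a B z)) hmp.measurable.aemeasurable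
    (hK.measurable.comp (measurable_affMap a B)).aestronglyMeasurable).symm

end Join

/-- Strictness is available only inside `U`, so it is used at `u ± t δ` with `t` small; plain
concavity on the segments from `u` to `u ± δ` carries it to the full step. -/
lemma midpoint_lt_of_strictConcaveOn {E : Type*} [NormedAddCommGroup E] [NormedSpace ℝ E]
    {h : E → ℝ} (hc : ConcaveOn ℝ Set.univ h) {U : Set E} (hU : IsOpen U)
    (hs : StrictConcaveOn ℝ U h) {u δ : E} (hu : u ∈ U) (hδ : δ ≠ 0) :
    (h (u + δ) + h (u - δ)) / 2 < h u := by
  have hcont : Continuous fun t : ℝ => (u + t • δ, u - t • δ) := by fun_prop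
  have hnhds : ∀ᶠ t in nhds (0 : ℝ), (u + t • δ, u - t • δ) ∈ U ×ˢ U := by
    refine hcont.continuousAt.eventually_mem ((hU.prod hU).mem_nhds ?_)
    simpa using hu
  obtain ⟨t, ⟨ht, ht1⟩, ht0⟩ := ((hnhds.filter_mono nhdsWithin_le_nhds).and
    (Ioo_mem_nhdsGT (show (0 : ℝ) < 1 by norm_num))).exists
  have hne : u + t • δ ≠ u - t • δ := by
    intro heq
    have h2 : (2 * t) • δ = 0 := by
      rw [two_mul, add_smul]
      have := congrArg (fun w => w - u + t • δ) heq
      simpa using this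
    exact smul_ne_zero (mul_ne_zero two_ne_zero ht0.1.ne') hδ h2
  have h1 := hs.2 ht ht1 hne (by norm_num : (0 : ℝ) < 1 / 2) (by norm_num : (0 : ℝ) < 1 / 2)
    (by norm_num)
  have h2 := hc.2 (Set.mem_univ u) (Set.mem_univ (u + δ)) (by linarith [ht0.2] : 0 ≤ 1 - t)
    ht0.1.le (by ring)
  have h3 := hc.2 (Set.mem_univ u) (Set.mem_univ (u - δ)) (by linarith [ht0.2] : 0 ≤ 1 - t)
    ht0.1.le (by ring)
  have e1 : (1 / 2 : ℝ) • (u + t • δ) + (1 / 2 : ℝ) • (u - t • δ) = u := by module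
  have e2 : (1 - t) • u + t • (u + δ) = u + t • δ := by module
  have e3 : (1 - t) • u + t • (u - δ) = u - t • δ := by module
  rw [e1] at h1
  rw [e2] at h2
  rw [e3] at h3
  simp only [smul_eq_mul] at h1 h2 h3
  have h4 : t * (h (u + δ) + h (u - δ)) < t * (2 * h u) := by linarith
  have := lt_of_mul_lt_mul_left h4 ht0.1.le
  linarith

/-! ### Symmetry and strictness determine the minimizer along `σ`. -/

section Minimizer

variable {σ τ : Type*} [Fintype σ] [Fintype τ] [DecidableEq σ] [DecidableEq τ]
variable {K : EuclideanSpace ℝ (σ ⊕ τ) → ℝ}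

lemma mul_transpose_self_swap {O : Matrix σ σ ℝ} (hO : O * O.transpose = 1) :
    O.transpose * O = 1 := by
  rwa [mul_eq_one_comm] at hO

lemma norm_toLp_orthogonal_mulVec {O : Matrix σ σ ℝ} (hO : O * O.transpose = 1) (v : σ → ℝ) :
    ‖(WithLp.toLp 2 (O.mulVec v) : EuclideanSpace ℝ σ)‖ =
      ‖(WithLp.toLp 2 v : EuclideanSpace ℝ σ)‖ := by
  rw [← sq_eq_sq₀ (norm_nonneg _) (norm_nonneg _), ← real_inner_self_eq_norm_sq,
    ← real_inner_self_eq_norm_sq, EuclideanSpace.inner_toLp_toLp, EuclideanSpace.inner_toLp_toLp]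
  simp only [star_trivial]
  rw [Matrix.dotProduct_mulVec, Matrix.vecMul_mulVec, mul_transpose_self_swap hO,
    Matrix.vecMul_one]

lemma abs_det_orthogonal {O : Matrix σ σ ℝ} (hO : O * O.transpose = 1) : |O.det| = 1 := by
  have := congrArg Matrix.det hO
  rw [Matrix.det_mul, Matrix.det_transpose, Matrix.det_one] at this
  rcases mul_self_eq_one_iff.1 this with h | h <;> simp [h]

/-- The mean of a free energy minimizer vanishes along `σ`, and there is no correlation between
`σ` and `τ`. -/
lemma IsRadialConcave.fstPart_eq_zero_and_eq_zero (hK : IsRadialConcave K)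
    {a : EuclideanSpace ℝ (σ ⊕ τ)} {C : Matrix σ σ ℝ} {A : Matrix σ τ ℝ} {D : Matrix τ τ ℝ}
    (hC : C.det ≠ 0) (hD : D.det ≠ 0)
    (h : MinimizesFreeEnergy K a (Matrix.fromBlocks C A 0 D)) : fstPart a = 0 ∧ A = 0 := by
  have hdet : ∀ A' : Matrix σ τ ℝ, (Matrix.fromBlocks C A' 0 D).det = C.det * D.det :=
    fun A' => Matrix.det_fromBlocks_zero₂₁ _ _ _
  have hdet' : ∀ A' : Matrix σ τ ℝ, (Matrix.fromBlocks C A' 0 D).det ≠ 0 := fun A' => by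
    rw [hdet]; exact mul_ne_zero hC hD
  have hO : (-1 : Matrix σ σ ℝ) * (-1 : Matrix σ σ ℝ).transpose = 1 := by simp
  -- Reflecting the output along `σ` negates the mean, `C` and `A`; replacing `ξ_σ` by `-ξ_σ`
  -- restores `C`.
  set a₂ : EuclideanSpace ℝ (σ ⊕ τ) := join (-fstPart a) (sndPart a) with ha₂
  have hsnd : ∀ z, sndPart (affMap a (Matrix.fromBlocks C A 0 D) z) =
      sndPart (affMap a₂ (Matrix.fromBlocks C (-A) 0 D) z) := fun z => by
    rw [sndPart_affMap, sndPart_affMap, ha₂, sndPart_join]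
  obtain ⟨hint, hI⟩ := hK.integral_eq_of_norm_eq (a := a) (a' := a₂) (hdet' (-A)) hO (fun z => by
      rw [← norm_neg, fstPart_affMap, fstPart_affMap, fstPart_affMap_orthogonal,
        sndPart_affMap_orthogonal, ha₂, fstPart_join]
      congr 1
      ext i
      simp [Matrix.neg_mulVec, Matrix.mulVec_neg]
      ring) (fun z => by
      rw [sndPart_affMap, sndPart_affMap, sndPart_affMap_orthogonal, ha₂, sndPart_join,
        Matrix.zero_mulVec, Matrix.zero_mulVec]) h.integrable
  have hfe : freeEnergy K a₂ (Matrix.fromBlocks C (-A) 0 D) ≤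
      freeEnergy K a (Matrix.fromBlocks C A 0 D) := by
    rw [freeEnergy, freeEnergy, hI, hdet, hdet]
  have hBmid : (1 / 2 : ℝ) • (Matrix.fromBlocks C A 0 D + Matrix.fromBlocks C (-A) 0 D) =
      Matrix.fromBlocks C 0 0 D := by
    rw [Matrix.fromBlocks_add, Matrix.fromBlocks_smul]
    congr 1
    · module
    · module
    · module
    · module
  obtain ⟨-, hmid⟩ := hK.midpoint h (hdet' A) hint hfe hsnd (by rw [hBmid]; exact hdet' 0)
  -- All three determinants are `det C * det D`, so this is the equality case.
  have hmid := hmid (by rw [hBmid, hdet, hdet, hdet]; ring)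
  rw [hBmid] at hmid
  have hfib : ∀ᵐ y : EuclideanSpace ℝ τ,
      (ConcaveOn ℝ Set.univ fun x : EuclideanSpace ℝ σ => K (join x y)) ∧
        ∃ U : Set (EuclideanSpace ℝ σ), IsOpen U ∧ U.Nonempty ∧
          StrictConcaveOn ℝ U fun x => K (join x y) := hK.concave.and hK.strict
  have hzero : ∀ᵐ y : EuclideanSpace ℝ τ,
      fstPart a + WithLp.toLp 2 (A.mulVec y.ofLp) = 0 := by
    filter_upwards [ae_ae_join hmid,
      (quasiMeasurePreserving_affMap (sndPart a) hD).ae hfib] with y hy hy2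
    obtain ⟨hconc, U, hU, ⟨u, hu⟩, hstrict⟩ := hy2
    by_contra hδ
    have hV : IsOpen {x : EuclideanSpace ℝ σ | affMap 0 C x ∈ U} :=
      hU.preimage (continuous_affMap 0 C)
    -- A set of full measure is dense, so it meets the open set of `x` with `C x ∈ U`, nonempty
    -- because `C` is invertible.
    obtain ⟨x, hxV, hx⟩ := (Measure.dense_of_ae hy).exists_mem_open hV
      ⟨affMap (affMap 0 C⁻¹ (-0)) C⁻¹ u, by
        rw [Set.mem_ofPred_eq, (exists_affMap_inv 0 hC).2]; exact hu⟩
    have hlt := midpoint_lt_of_strictConcaveOn hconc hU hstrict hx hδ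
    have e0 : affMap ((1 / 2 : ℝ) • (a + a₂)) (Matrix.fromBlocks C 0 0 D) (join x y) =
        join (affMap 0 C x) (affMap (sndPart a) D y) := by
      refine eq_of_parts ?_ ?_
      · rw [fstPart_affMap, fstPart_join, fstPart_join, sndPart_join, ha₂]
        ext i
        simp [fstPart, join, affMap]
      · rw [sndPart_affMap, fstPart_join, sndPart_join, sndPart_join, ha₂]
        ext i
        simp [sndPart, join, affMap]
        ring
    have e1 : affMap a (Matrix.fromBlocks C A 0 D) (join x y) =
        join (affMap 0 C x + (fstPart a + WithLp.toLp 2 (A.mulVec y.ofLp)))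
          (affMap (sndPart a) D y) := by
      refine eq_of_parts ?_ ?_
      · rw [fstPart_affMap, fstPart_join, fstPart_join, sndPart_join]
        ext i
        simp [fstPart, affMap]
        ring
      · rw [sndPart_affMap, fstPart_join, sndPart_join, sndPart_join]
        ext i
        simp [sndPart, affMap]
    have e2 : affMap a₂ (Matrix.fromBlocks C (-A) 0 D) (join x y) =
        join (affMap 0 C x - (fstPart a + WithLp.toLp 2 (A.mulVec y.ofLp)))
          (affMap (sndPart a) D y) := by
      refine eq_of_parts ?_ ?_
      · rw [fstPart_affMap, ha₂, fstPart_join, fstPart_join, sndPart_join, fstPart_join]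
        ext i
        simp [fstPart, affMap, Matrix.neg_mulVec]
        ring
      · rw [sndPart_affMap, ha₂, sndPart_join, fstPart_join, sndPart_join, sndPart_join]
        ext i
        simp [sndPart, affMap]
    rw [Set.mem_ofPred_eq, e0, e1, e2] at hxV
    linarith
  -- The offset is continuous in `y`, so vanishing almost everywhere means vanishing everywhere; `y
  -- = 0` isolates the mean, and then `A` vanishes.
  have hall : (fun y : EuclideanSpace ℝ τ => fstPart a + WithLp.toLp 2 (A.mulVec y.ofLp)) =
      fun _ => 0 := by
    refine (Continuous.ae_eq_iff_eq volume ?_ continuous_const).1 hzero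
    have : Continuous fun v : τ → ℝ => A.mulVec v := by fun_prop
    fun_prop
  have ha0 : fstPart a = 0 := by
    have := congrFun hall 0
    simpa using this
  refine ⟨ha0, ?_⟩
  apply Matrix.mulVec_injective
  funext v
  have := congrArg WithLp.ofLp (congrFun hall (WithLp.toLp 2 v))
  simpa [ha0] using this

lemma log_abs_det_fromBlocks_diagonal {D : Matrix τ τ ℝ} (hD : D.det ≠ 0) {l : σ → ℝ}
    (hl : ∀ i, 0 < l i) :
    (Matrix.fromBlocks (Matrix.diagonal l) 0 0 D).det ≠ 0 ∧
    Real.log |(Matrix.fromBlocks (Matrix.diagonal l) 0 0 D).det| =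
      ∑ i, Real.log (l i) + Real.log |D.det| := by
  have hpos : 0 < ∏ i, l i := Finset.prod_pos fun i _ => hl i
  rw [Matrix.det_fromBlocks_zero₂₁, Matrix.det_diagonal]
  refine ⟨mul_ne_zero hpos.ne' hD, ?_⟩
  rw [abs_mul, Real.log_mul (abs_pos.2 hpos.ne').ne' (abs_pos.2 hD).ne', abs_of_pos hpos,
    Real.log_prod fun i _ => (hl i).ne']

/-- Strict convexity of the free energy along diagonal matrices. -/
lemma IsRadialConcave.diagonal_unique (hK : IsRadialConcave K)
    {a : EuclideanSpace ℝ (σ ⊕ τ)} {l l' : σ → ℝ} {D : Matrix τ τ ℝ} (hD : D.det ≠ 0)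
    (hl : ∀ i, 0 < l i) (hl' : ∀ i, 0 < l' i)
    (h : MinimizesFreeEnergy K a (Matrix.fromBlocks (Matrix.diagonal l) 0 0 D))
    (hint : Integrable (fun z => K (affMap a (Matrix.fromBlocks (Matrix.diagonal l') 0 0 D) z))
      (stdGaussian (EuclideanSpace ℝ (σ ⊕ τ))))
    (hle : freeEnergy K a (Matrix.fromBlocks (Matrix.diagonal l') 0 0 D) ≤
      freeEnergy K a (Matrix.fromBlocks (Matrix.diagonal l) 0 0 D)) : l = l' := by
  have hBmid : (1 / 2 : ℝ) • (Matrix.fromBlocks (Matrix.diagonal l) 0 0 D +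
      Matrix.fromBlocks (Matrix.diagonal l') 0 0 D) =
      Matrix.fromBlocks (Matrix.diagonal fun i => (1 / 2 : ℝ) * l i + (1 / 2 : ℝ) * l' i) 0 0 D := by
    rw [Matrix.fromBlocks_add, Matrix.fromBlocks_smul]
    congr 1
    · rw [Matrix.diagonal_add, ← Matrix.diagonal_smul]
      congr 1; funext i; simp; ring
    · simp
    · simp
    · module
  have hm : ∀ i, 0 < (1 / 2 : ℝ) * l i + (1 / 2 : ℝ) * l' i := fun i => by
    have := hl i; have := hl' i; positivity
  obtain ⟨d1, e1⟩ := log_abs_det_fromBlocks_diagonal hD hl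
  obtain ⟨d2, e2⟩ := log_abs_det_fromBlocks_diagonal hD hl'
  obtain ⟨d3, e3⟩ := log_abs_det_fromBlocks_diagonal hD hm
  obtain ⟨hlog, -⟩ := hK.midpoint h d1 hint hle (fun z => by
    rw [sndPart_affMap, sndPart_affMap]) (by rw [hBmid]; exact d3)
  rw [hBmid, e1, e2, e3] at hlog
  by_contra hne
  obtain ⟨i, hi⟩ := Function.ne_iff.1 hne
  -- Strict concavity of `log` contradicts the bound on the midpoint determinant.
  have hlt : ∑ i, (1 / 2 * Real.log (l i) + 1 / 2 * Real.log (l' i)) <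
      ∑ i, Real.log ((1 / 2 : ℝ) * l i + (1 / 2 : ℝ) * l' i) := by
    refine Finset.sum_lt_sum (fun k _ => ?_) ⟨i, Finset.mem_univ i, ?_⟩
    · exact strictConcaveOn_log_Ioi.concaveOn.2 (hl k) (hl' k) (by norm_num) (by norm_num)
        (by norm_num)
    · exact strictConcaveOn_log_Ioi.2 (hl i) (hl' i) hi (by norm_num) (by norm_num) (by norm_num)
  rw [Finset.sum_add_distrib, ← Finset.mul_sum, ← Finset.mul_sum] at hlt
  linarith

/-- With zero mean along `σ`, an orthogonal factor on the left changes neither the norm of the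
`σ`-part nor `|det|`. -/
lemma IsRadialConcave.minimizes_diagonal (hK : IsRadialConcave K)
    {a : EuclideanSpace ℝ (σ ⊕ τ)} (ha : fstPart a = 0) {O : Matrix σ σ ℝ}
    (hO : O * O.transpose = 1) {l : σ → ℝ} {D : Matrix τ τ ℝ} (hD : D.det ≠ 0)
    (hl : ∀ i, 0 < l i)
    (h : MinimizesFreeEnergy K a (Matrix.fromBlocks (O * Matrix.diagonal l) 0 0 D)) :
    MinimizesFreeEnergy K a (Matrix.fromBlocks (Matrix.diagonal l) 0 0 D) := by
  obtain ⟨d1, e1⟩ := log_abs_det_fromBlocks_diagonal hD hl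
  have hone : (1 : Matrix σ σ ℝ) * (1 : Matrix σ σ ℝ).transpose = 1 := by simp
  obtain ⟨hint, hI⟩ := hK.integral_eq_of_norm_eq (a := a) (a' := a) d1 hone (fun z => by
      rw [Matrix.fromBlocks_one, affMap_zero_one, fstPart_affMap, fstPart_affMap, ha, zero_add,
        zero_add, Matrix.zero_mulVec, add_zero, add_zero, ← Matrix.mulVec_mulVec,
        norm_toLp_orthogonal_mulVec hO]) (fun z => by
      rw [Matrix.fromBlocks_one, affMap_zero_one, sndPart_affMap, sndPart_affMap]) h.integrable
  have hfe : freeEnergy K a (Matrix.fromBlocks (Matrix.diagonal l) 0 0 D) =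
      freeEnergy K a (Matrix.fromBlocks (O * Matrix.diagonal l) 0 0 D) := by
    rw [freeEnergy, freeEnergy, hI, Matrix.det_fromBlocks_zero₂₁, Matrix.det_fromBlocks_zero₂₁,
      Matrix.det_mul, abs_mul, abs_mul, abs_mul, abs_det_orthogonal hO, one_mul]
  exact ⟨hint, fun a' B' hB' hint' => hfe ▸ h.le a' B' hB' hint'⟩

/-- Swapping two entries of `l` conjugates by a permutation matrix and preserves the free energy, so
uniqueness among diagonals makes the entries equal. -/
lemma IsRadialConcave.diagonal_const (hK : IsRadialConcave K)
    {a : EuclideanSpace ℝ (σ ⊕ τ)} (ha : fstPart a = 0) {l : σ → ℝ} {D : Matrix τ τ ℝ}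
    (hD : D.det ≠ 0) (hl : ∀ i, 0 < l i)
    (h : MinimizesFreeEnergy K a (Matrix.fromBlocks (Matrix.diagonal l) 0 0 D)) (i j : σ) :
    l i = l j := by
  set s : Equiv.Perm σ := Equiv.swap i j with hs
  have hO : s.permMatrix ℝ * (s.permMatrix ℝ).transpose = 1 := by
    rw [Matrix.transpose_permMatrix, ← Matrix.permMatrix_mul]
    simp
  have hl' : ∀ k, 0 < (l ∘ s) k := fun k => hl _
  obtain ⟨d1, e1⟩ := log_abs_det_fromBlocks_diagonal hD hl
  obtain ⟨d2, e2⟩ := log_abs_det_fromBlocks_diagonal hD hl'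
  obtain ⟨hint, hI⟩ := hK.integral_eq_of_norm_eq (a := a) (a' := a) d2 hO (fun z => by
      rw [← sq_eq_sq₀ (norm_nonneg _) (norm_nonneg _), fstPart_affMap, fstPart_affMap,
        fstPart_affMap_orthogonal, ha, EuclideanSpace.real_norm_sq_eq, EuclideanSpace.real_norm_sq_eq,
        ← Equiv.sum_comp s]
      refine Finset.sum_congr rfl fun k _ => ?_
      simp [Matrix.mulVec_diagonal, Matrix.permMatrix_mulVec, fstPart, hs]) (fun z => by
      rw [sndPart_affMap, sndPart_affMap, sndPart_affMap_orthogonal, Matrix.zero_mulVec,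
        Matrix.zero_mulVec]) h.integrable
  have := hK.diagonal_unique hD hl hl' h hint (by
    rw [freeEnergy, freeEnergy, hI, e1, e2]
    simp only [Function.comp]
    rw [Equiv.sum_comp s fun k => Real.log (l k)])
  simpa [hs] using congrFun this i

end Minimizer

/-! ### Potentials that split into a function of `x` plus a function of `y`. -/

section Separable

variable {σ τ : Type*} [Fintype σ] [Fintype τ]

lemma measurePreserving_join_stdGaussian :
    MeasurePreserving (fun q : EuclideanSpace ℝ τ × EuclideanSpace ℝ σ => join q.2 q.1)
      ((stdGaussian (EuclideanSpace ℝ τ)).prod (stdGaussian (EuclideanSpace ℝ σ)))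
      (stdGaussian (EuclideanSpace ℝ (σ ⊕ τ))) := by
  have hm : Measurable fun q : EuclideanSpace ℝ τ × EuclideanSpace ℝ σ => join q.2 q.1 :=
    measurePreserving_join.measurable
  refine ⟨hm, ?_⟩
  have : IsProbabilityMeasure (((stdGaussian (EuclideanSpace ℝ τ)).prod
    (stdGaussian (EuclideanSpace ℝ σ))).map fun q => join q.2 q.1) :=
    Measure.isProbabilityMeasure_map hm.aemeasurable
  apply Measure.ext_of_charFun
  ext t
  rw [charFun_apply, integral_map hm.aemeasurable (Measurable.aestronglyMeasurable (by fun_prop)),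
    charFun_stdGaussian]
  have h1 : ∀ q : EuclideanSpace ℝ τ × EuclideanSpace ℝ σ,
      Complex.exp (↑(inner ℝ (join q.2 q.1) t) * Complex.I) =
        Complex.exp (↑(inner ℝ q.1 (sndPart t)) * Complex.I) *
          Complex.exp (↑(inner ℝ q.2 (fstPart t)) * Complex.I) := by
    intro q
    rw [← Complex.exp_add, ← add_mul, ← Complex.ofReal_add]
    congr 3
    simp only [PiLp.inner_apply, Fintype.sum_sum_type]
    rw [add_comm]
    rfl
  simp_rw [h1]
  rw [integral_prod_mul (fun y : EuclideanSpace ℝ τ =>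
      Complex.exp (↑(inner ℝ y (sndPart t)) * Complex.I))
    (fun x : EuclideanSpace ℝ σ => Complex.exp (↑(inner ℝ x (fstPart t)) * Complex.I)),
    ← charFun_apply, ← charFun_apply, charFun_stdGaussian, charFun_stdGaussian, ← Complex.exp_add]
  congr 1
  have h2 : ‖t‖ ^ 2 = ‖fstPart t‖ ^ 2 + ‖sndPart t‖ ^ 2 := by
    simp only [EuclideanSpace.real_norm_sq_eq, Fintype.sum_sum_type]
    rfl
  have h3 := congrArg Complex.ofReal h2
  push_cast at h3
  rw [h3]
  ring

variable [DecidableEq σ] [DecidableEq τ]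
variable {K : EuclideanSpace ℝ (σ ⊕ τ) → ℝ} {k : EuclideanSpace ℝ σ → ℝ}
  {h : EuclideanSpace ℝ τ → ℝ}

lemma affMap_fromBlocks_diagonal_join {a : EuclideanSpace ℝ (σ ⊕ τ)} (ha : fstPart a = 0)
    (C : Matrix σ σ ℝ) (D : Matrix τ τ ℝ) (x : EuclideanSpace ℝ σ) (y : EuclideanSpace ℝ τ) :
    affMap a (Matrix.fromBlocks C 0 0 D) (join x y) =
      join (affMap 0 C x) (affMap (sndPart a) D y) := by
  refine eq_of_parts ?_ ?_
  · rw [fstPart_affMap, fstPart_join, fstPart_join, ha, Matrix.zero_mulVec, add_zero]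
    rfl
  · rw [sndPart_affMap, sndPart_join, sndPart_join, Matrix.zero_mulVec, zero_add]
    rfl

lemma ae_eq_add_of_separable (hsep : ∀ᵐ y, ∀ x, K (join x y) = k x + h y)
    {a : EuclideanSpace ℝ (σ ⊕ τ)} (ha : fstPart a = 0) (C : Matrix σ σ ℝ) {D : Matrix τ τ ℝ}
    (hD : D.det ≠ 0) :
    ∀ᵐ q ∂((stdGaussian (EuclideanSpace ℝ τ)).prod (stdGaussian (EuclideanSpace ℝ σ))),
      K (affMap a (Matrix.fromBlocks C 0 0 D) (join q.2 q.1)) =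
        k (affMap 0 C q.2) + h (affMap (sndPart a) D q.1) := by
  have h1 : ∀ᵐ y ∂(stdGaussian (EuclideanSpace ℝ τ)), ∀ x,
      K (join x (affMap (sndPart a) D y)) = k x + h (affMap (sndPart a) D y) :=
    stdGaussian_absolutelyContinuous.ae_le ((quasiMeasurePreserving_affMap _ hD).ae hsep)
  filter_upwards [Measure.quasiMeasurePreserving_fst.ae h1] with q hq
  rw [affMap_fromBlocks_diagonal_join ha, hq]

lemma integrable_of_separable (hsep : ∀ᵐ y, ∀ x, K (join x y) = k x + h y)
    {a : EuclideanSpace ℝ (σ ⊕ τ)} (ha : fstPart a = 0) {C : Matrix σ σ ℝ} {D : Matrix τ τ ℝ}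
    (hD : D.det ≠ 0)
    (hint : Integrable (fun z => K (affMap a (Matrix.fromBlocks C 0 0 D) z))
      (stdGaussian (EuclideanSpace ℝ (σ ⊕ τ)))) :
    Integrable (fun x => k (affMap 0 C x)) (stdGaussian (EuclideanSpace ℝ σ)) ∧
      Integrable (fun y => h (affMap (sndPart a) D y)) (stdGaussian (EuclideanSpace ℝ τ)) := by
  have h1 := (integrable_congr (ae_eq_add_of_separable hsep ha C hD)).1
    (measurePreserving_join_stdGaussian.integrable_comp_of_integrable hint)
  -- On an integrable section of the product the other summand is a constant and can be subtracted.
  obtain ⟨y, hy⟩ := h1.prod_right_ae.exists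
  obtain ⟨x, hx⟩ := h1.prod_left_ae.exists
  refine ⟨(hy.sub (integrable_const (h (affMap (sndPart a) D y)))).congr (.of_forall fun x => ?_),
    (hx.sub (integrable_const (k (affMap 0 C x)))).congr (.of_forall fun y => ?_)⟩
  · simp
  · simp

lemma integral_of_separable (hK : Measurable K) (hsep : ∀ᵐ y, ∀ x, K (join x y) = k x + h y)
    {a : EuclideanSpace ℝ (σ ⊕ τ)} (ha : fstPart a = 0) {C : Matrix σ σ ℝ} {D : Matrix τ τ ℝ}
    (hD : D.det ≠ 0)
    (hk : Integrable (fun x => k (affMap 0 C x)) (stdGaussian (EuclideanSpace ℝ σ)))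
    (hh : Integrable (fun y => h (affMap (sndPart a) D y)) (stdGaussian (EuclideanSpace ℝ τ))) :
    Integrable (fun z => K (affMap a (Matrix.fromBlocks C 0 0 D) z))
      (stdGaussian (EuclideanSpace ℝ (σ ⊕ τ))) ∧
    ∫ z, K (affMap a (Matrix.fromBlocks C 0 0 D) z) ∂(stdGaussian (EuclideanSpace ℝ (σ ⊕ τ))) =
      ∫ x, k (affMap 0 C x) ∂(stdGaussian (EuclideanSpace ℝ σ)) +
        ∫ y, h (affMap (sndPart a) D y) ∂(stdGaussian (EuclideanSpace ℝ τ)) := by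
  have hae := ae_eq_add_of_separable hsep ha C hD
  have hk' := hk.comp_snd (stdGaussian (EuclideanSpace ℝ τ))
  have hh' := hh.comp_fst (stdGaussian (EuclideanSpace ℝ σ))
  have hm : AEStronglyMeasurable (fun z => K (affMap a (Matrix.fromBlocks C 0 0 D) z))
      (stdGaussian (EuclideanSpace ℝ (σ ⊕ τ))) :=
    (hK.comp (measurable_affMap a _)).aestronglyMeasurable
  refine ⟨?_, ?_⟩
  · exact (measurePreserving_join_stdGaussian.integrable_comp hm).1
      ((integrable_congr hae).2 (hk'.add hh'))
  · rw [← measurePreserving_join_stdGaussian.map_eq, integral_map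
      measurePreserving_join_stdGaussian.measurable.aemeasurable
      (by rwa [measurePreserving_join_stdGaussian.map_eq]), integral_congr_ae hae,
      integral_add hk' hh']
    congr 1
    · rw [integral_fun_snd (fun x => k (affMap 0 C x))]; simp
    · rw [integral_fun_fst (fun y => h (affMap (sndPart a) D y))]; simp

/-- If `K` splits into a function of `x` plus a function of `y`, the optimal scale along `σ` does
not depend on the minimizer. -/
lemma IsRadialConcave.diagonal_unique_of_separable (hK : IsRadialConcave K)
    (hsep : ∀ᵐ y, ∀ x, K (join x y) = k x + h y)
    {a a' : EuclideanSpace ℝ (σ ⊕ τ)} (ha : fstPart a = 0) (ha' : fstPart a' = 0)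
    {l l' : σ → ℝ} {D D' : Matrix τ τ ℝ} (hD : D.det ≠ 0) (hD' : D'.det ≠ 0)
    (hl : ∀ i, 0 < l i) (hl' : ∀ i, 0 < l' i)
    (hmin : MinimizesFreeEnergy K a (Matrix.fromBlocks (Matrix.diagonal l) 0 0 D))
    (hmin' : MinimizesFreeEnergy K a' (Matrix.fromBlocks (Matrix.diagonal l') 0 0 D')) :
    l = l' := by
  obtain ⟨k1, h1⟩ := integrable_of_separable hsep ha hD hmin.integrable
  obtain ⟨k2, h2⟩ := integrable_of_separable hsep ha' hD' hmin'.integrable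
  obtain ⟨-, e11⟩ := integral_of_separable hK.measurable hsep ha hD k1 h1
  obtain ⟨-, e22⟩ := integral_of_separable hK.measurable hsep ha' hD' k2 h2
  obtain ⟨i21, e21⟩ := integral_of_separable hK.measurable hsep ha hD k2 h1
  obtain ⟨i12, e12⟩ := integral_of_separable hK.measurable hsep ha' hD' k1 h2
  obtain ⟨-, d11⟩ := log_abs_det_fromBlocks_diagonal hD hl
  obtain ⟨-, d22⟩ := log_abs_det_fromBlocks_diagonal hD' hl'
  obtain ⟨-, d21⟩ := log_abs_det_fromBlocks_diagonal hD hl'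
  obtain ⟨n12, d12⟩ := log_abs_det_fromBlocks_diagonal hD' hl
  -- The second minimizer is tested with `l` in place of `l'`. Its `τ`-terms cancel, so the
  -- resulting inequality carries over to `a` and `D`.
  have hle := hmin'.le a' _ n12 i12
  refine hK.diagonal_unique hD hl hl' hmin i21 ?_
  rw [freeEnergy, freeEnergy, e22, e12, d22, d12] at hle
  rw [freeEnergy, freeEnergy, e21, e11, d21, d11]
  linarith

end Separable

/-! ### Block triangular factors of the covariance. -/

section Factorization

variable {σ τ : Type*} [Fintype σ] [Fintype τ] [DecidableEq σ] [DecidableEq τ]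

lemma exists_orthogonal_mul_diagonal {V : Matrix σ σ ℝ} (hV : V.PosDef) :
    ∃ (O : Matrix σ σ ℝ) (l : σ → ℝ), O * O.transpose = 1 ∧ (∀ i, 0 < l i) ∧
      V = (O * Matrix.diagonal l) * (O * Matrix.diagonal l).transpose := by
  have hpos := hV.eigenvalues_pos
  refine ⟨hV.isHermitian.eigenvectorUnitary, fun i => Real.sqrt (hV.isHermitian.eigenvalues i), ?_,
    fun i => Real.sqrt_pos.2 (hpos i), ?_⟩
  · have : (hV.isHermitian.eigenvectorUnitary : Matrix σ σ ℝ) *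
        star (hV.isHermitian.eigenvectorUnitary : Matrix σ σ ℝ) = 1 :=
      Unitary.coe_mul_star_self hV.isHermitian.eigenvectorUnitary
    rwa [Matrix.star_eq_conjTranspose, Matrix.conjTranspose_eq_transpose_of_trivial] at this
  · conv_lhs => rw [hV.isHermitian.spectral_theorem]
    rw [Unitary.conjStarAlgAut_apply, Matrix.transpose_mul, Matrix.diagonal_transpose,
      Matrix.star_eq_conjTranspose, Matrix.conjTranspose_eq_transpose_of_trivial]
    simp only [Matrix.mul_assoc]
    congr 1
    rw [← Matrix.mul_assoc (Matrix.diagonal _) (Matrix.diagonal _), Matrix.diagonal_mul_diagonal]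
    congr 2
    funext i
    simp [Real.mul_self_sqrt (hpos i).le]

/-- A block triangular factorization of a positive definite matrix. -/
lemma exists_blockTriangular_factorization {S : Matrix (σ ⊕ τ) (σ ⊕ τ) ℝ} (hS : S.PosDef) :
    ∃ (O : Matrix σ σ ℝ) (l : σ → ℝ) (A : Matrix σ τ ℝ), O * O.transpose = 1 ∧ (∀ i, 0 < l i) ∧
      (CFC.sqrt S.toBlocks₂₂).det ≠ 0 ∧
      S = Matrix.fromBlocks (O * Matrix.diagonal l) A 0 (CFC.sqrt S.toBlocks₂₂) *
        (Matrix.fromBlocks (O * Matrix.diagonal l) A 0 (CFC.sqrt S.toBlocks₂₂)).transpose := by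
  have hW : S.toBlocks₂₂.PosDef := hS.submatrix Sum.inr_injective
  have hsymm : S.toBlocks₂₁ = S.toBlocks₁₂.conjTranspose := by
    have := hS.isHermitian.eq
    ext i j
    exact (congrFun (congrFun this (Sum.inr i)) (Sum.inl j)).symm
  have hSb : Matrix.fromBlocks S.toBlocks₁₁ S.toBlocks₁₂ S.toBlocks₁₂.conjTranspose S.toBlocks₂₂ =
      S := by rw [← hsymm, Matrix.fromBlocks_toBlocks]
  have := hW.isUnit.invertible
  have hschur : (S.toBlocks₁₁ - S.toBlocks₁₂ * S.toBlocks₂₂⁻¹ *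
      S.toBlocks₁₂.conjTranspose).PosSemidef := by
    rw [← Matrix.PosDef.fromBlocks₂₂ _ _ hW, hSb]; exact hS.posSemidef
  have hschur' : (S.toBlocks₁₁ - S.toBlocks₁₂ * S.toBlocks₂₂⁻¹ *
      S.toBlocks₁₂.conjTranspose).PosDef := by
    rw [hschur.posDef_iff_det_ne_zero]
    have h1 := hS.det_pos.ne'
    rw [← hSb, Matrix.det_fromBlocks₂₂, Matrix.invOf_eq_nonsing_inv] at h1
    exact right_ne_zero_of_mul h1
  obtain ⟨O, l, hO, hl, hOl⟩ := exists_orthogonal_mul_diagonal hschur'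
  have hD := isUnit_det_sqrt hW
  have hDu : IsUnit (CFC.sqrt S.toBlocks₂₂).det := isUnit_iff_ne_zero.2 hD
  have hDD := CFC.sqrt_mul_sqrt_self _ hW.posSemidef.nonneg
  -- With `D` the root of the `τ`-block, this `A` gives `A Dᵀ = S₁₂`, and `S₁₁ - A Aᵀ` is the Schur
  -- complement, factored by `O` and `l`.
  refine ⟨O, l, S.toBlocks₁₂ * (CFC.sqrt S.toBlocks₂₂)⁻¹, hO, hl, hD, ?_⟩
  have hinvT : ((CFC.sqrt S.toBlocks₂₂)⁻¹).transpose = (CFC.sqrt S.toBlocks₂₂)⁻¹ := by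
    rw [Matrix.transpose_nonsing_inv, transpose_sqrt]
  have hinv : (CFC.sqrt S.toBlocks₂₂)⁻¹ * (CFC.sqrt S.toBlocks₂₂)⁻¹ = S.toBlocks₂₂⁻¹ := by
    rw [← Matrix.mul_inv_rev, hDD]
  rw [Matrix.fromBlocks_transpose, Matrix.fromBlocks_multiply, ← hOl, transpose_sqrt,
    Matrix.transpose_mul, hinvT]
  conv_lhs => rw [← hSb]
  rw [Matrix.fromBlocks_inj]
  refine ⟨?_, ?_, ?_, ?_⟩
  · simp only [Matrix.mul_assoc]
    rw [← Matrix.mul_assoc (CFC.sqrt S.toBlocks₂₂)⁻¹, hinv,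
      Matrix.conjTranspose_eq_transpose_of_trivial, sub_add_cancel]
  · rw [Matrix.mul_assoc S.toBlocks₁₂, Matrix.nonsing_inv_mul _ hDu]; simp
  · rw [← Matrix.mul_assoc, Matrix.mul_nonsing_inv _ hDu]; simp
  · simp [hDD]

end Factorization

/-! ### Whitening turns elliptical symmetry into radial symmetry. -/

section Whitening

variable {σ τ : Type*} [Fintype σ] [Fintype τ] [DecidableEq σ] [DecidableEq τ]

/-- The matrix of the map that whitens the coordinates `σ` and fixes the coordinates `τ`. -/
def whitening (τ : Type*) [DecidableEq τ] (M : Matrix σ σ ℝ) : Matrix (σ ⊕ τ) (σ ⊕ τ) ℝ :=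
  Matrix.fromBlocks (CFC.sqrt M) 0 0 1

lemma det_whitening_ne_zero {M : Matrix σ σ ℝ} (hM : M.PosDef) : (whitening τ M).det ≠ 0 := by
  rw [whitening, Matrix.det_fromBlocks_zero₂₁, Matrix.det_one, mul_one]
  exact isUnit_det_sqrt hM

omit [Fintype τ] in
lemma transpose_whitening (M : Matrix σ σ ℝ) :
    (whitening τ M).transpose = whitening τ M := by
  rw [whitening, Matrix.fromBlocks_transpose, transpose_sqrt]
  simp

lemma affMap_whitening_join (m : EuclideanSpace ℝ σ) (M : Matrix σ σ ℝ)
    (x : EuclideanSpace ℝ σ) (y : EuclideanSpace ℝ τ) :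
    affMap (join m 0) (whitening τ M) (join x y) = join (affMap m (CFC.sqrt M) x) y := by
  refine eq_of_parts ?_ ?_
  · rw [whitening, fstPart_affMap, fstPart_join, fstPart_join, Matrix.zero_mulVec, add_zero]
    rfl
  · rw [whitening, sndPart_affMap, sndPart_join, sndPart_join, Matrix.zero_mulVec, zero_add,
      Matrix.one_mulVec]
    exact zero_add _

lemma mahalanobis_affMap_sqrt (m : EuclideanSpace ℝ σ) {M : Matrix σ σ ℝ} (hM : M.PosDef)
    (x : EuclideanSpace ℝ σ) : mahalanobis M m (affMap m (CFC.sqrt M) x) = ‖x‖ := by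
  have h1 : (affMap m (CFC.sqrt M) x - m).ofLp = (CFC.sqrt M).mulVec x.ofLp := by
    simp [affMap]
  have hu : IsUnit (CFC.sqrt M).det := isUnit_iff_ne_zero.2 (isUnit_det_sqrt hM)
  have h2 : M⁻¹ * CFC.sqrt M = (CFC.sqrt M)⁻¹ := by
    nth_rw 1 [← CFC.sqrt_mul_sqrt_self M hM.posSemidef.nonneg]
    rw [Matrix.mul_inv_rev, Matrix.mul_assoc, Matrix.nonsing_inv_mul _ hu, Matrix.mul_one]
  rw [mahalanobis, h1, Matrix.mulVec_mulVec, h2, Matrix.dotProduct_mulVec,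
    ← Matrix.mulVec_transpose, Matrix.mulVec_mulVec, Matrix.transpose_nonsing_inv, transpose_sqrt,
    Matrix.nonsing_inv_mul _ hu, Matrix.one_mulVec, EuclideanSpace.norm_eq]
  congr 1
  simp [dotProduct, sq]

lemma affMap_convex_comb {ι : Type*} [Fintype ι] [DecidableEq ι] (a : EuclideanSpace ℝ ι)
    (B : Matrix ι ι ℝ) (x y : EuclideanSpace ℝ ι) {s t : ℝ} (hst : s + t = 1) :
    affMap a B (s • x + t • y) = s • affMap a B x + t • affMap a B y := by
  simp only [affMap, map_add, map_smul, smul_add]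
  have : a = s • a + t • a := by rw [← add_smul, hst, one_smul]
  conv_lhs => rw [this]
  abel

variable {p : EuclideanSpace ℝ (σ ⊕ τ) → ℝ}

omit [DecidableEq σ] [DecidableEq τ] in
lemma ae_marginalDensity_pos (hp : IsProbDensity p) (hpos : ∀ᵐ z, 0 < p z) :
    ∀ᵐ y, 0 < marginalDensity p y := by
  -- Finiteness matters: a nonintegrable section would give the marginal the default value `0`.
  have hint : ∀ᵐ y : EuclideanSpace ℝ τ, Integrable fun x : EuclideanSpace ℝ σ => p (join x y) :=
    (measurePreserving_join.integrable_comp_of_integrable hp.integrable).prod_right_ae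
  filter_upwards [ae_ae_join hpos, hint] with y hy hiy
  have h0 : 0 ≤ marginalDensity p y := integral_nonneg fun x => hp.nonneg _
  refine h0.lt_of_ne' fun heq => ?_
  have h1 := (integral_eq_zero_iff_of_nonneg (fun x => hp.nonneg _) hiy).1 heq
  obtain ⟨x, hx, hx'⟩ := (hy.and h1).exists
  exact hx.ne' hx'

/-- The logarithm of the whitened density. -/
def whitenedLog (p : EuclideanSpace ℝ (σ ⊕ τ) → ℝ) (m : EuclideanSpace ℝ σ) (M : Matrix σ σ ℝ)
    (z : EuclideanSpace ℝ (σ ⊕ τ)) : ℝ :=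
  Real.log (p (affMap (join m 0) (whitening τ M) z))

/-- For fixed `y` the section is the log conditional density plus a constant, so it inherits
symmetry and concavity. -/
lemma whitenedLog_join {m : EuclideanSpace ℝ σ} {M : Matrix σ σ ℝ} {y : EuclideanSpace ℝ τ}
    (hy : 0 < marginalDensity p y) (hlc : SomewhereStrictlyLogConcave (condDensity p y))
    (x : EuclideanSpace ℝ σ) : whitenedLog p m M (join x y) =
      Real.log (condDensity p y (affMap m (CFC.sqrt M) x)) + Real.log (marginalDensity p y) := by
  rw [← Real.log_mul (hlc.pos _).ne' hy.ne', condDensity, div_mul_cancel₀ _ hy.ne', whitenedLog,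
    affMap_whitening_join]

lemma isRadialConcave_whitenedLog (hp : IsProbDensity p) (hpos : ∀ᵐ z, 0 < p z)
    {m : EuclideanSpace ℝ σ} {M : Matrix σ σ ℝ} (hM : M.PosDef)
    (hell : ∀ y, 0 < marginalDensity p y → IsEllipticallySymmetric (condDensity p y) m M)
    (hlc : ∀ y, 0 < marginalDensity p y → SomewhereStrictlyLogConcave (condDensity p y)) :
    IsRadialConcave (whitenedLog p m M) where
  measurable := Real.measurable_log.comp (hp.measurable.comp (measurable_affMap _ _))
  integrable_exp := by
    refine (integrable_comp_affMap (join m 0) (det_whitening_ne_zero hM) hp.integrable).congr ?_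
    filter_upwards [(quasiMeasurePreserving_affMap (join m 0) (det_whitening_ne_zero hM)).ae hpos]
      with z hz
    rw [whitenedLog, Real.exp_log hz]
  radial := by
    filter_upwards [ae_marginalDensity_pos hp hpos] with y hy x x' hxx
    rw [whitenedLog_join hy (hlc y hy), whitenedLog_join hy (hlc y hy),
      (hell y hy).eq_of_mahalanobis_eq (affMap m (CFC.sqrt M) x) (affMap m (CFC.sqrt M) x')]
    rwa [mahalanobis_affMap_sqrt m hM, mahalanobis_affMap_sqrt m hM]
  concave := by
    filter_upwards [ae_marginalDensity_pos hp hpos] with y hy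
    refine ⟨convex_univ, fun x _ x' _ s t hs ht hst => ?_⟩
    have h := (hlc y hy).concave.2 (Set.mem_univ (affMap m (CFC.sqrt M) x))
      (Set.mem_univ (affMap m (CFC.sqrt M) x')) hs ht hst
    rw [← affMap_convex_comb m _ x x' hst] at h
    simp only [whitenedLog_join hy (hlc y hy), smul_eq_mul] at h ⊢
    have : Real.log (marginalDensity p y) =
        s * Real.log (marginalDensity p y) + t * Real.log (marginalDensity p y) := by
      rw [← add_mul, hst, one_mul]
    linarith
  strict := by
    filter_upwards [ae_marginalDensity_pos hp hpos] with y hy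
    obtain ⟨U, hU, ⟨u, hu⟩, hs⟩ := (hlc y hy).strict
    have hinv := exists_affMap_inv m (isUnit_det_sqrt hM)
    refine ⟨{x | affMap m (CFC.sqrt M) x ∈ U}, hU.preimage (continuous_affMap m _),
      ⟨_, show affMap m (CFC.sqrt M) (affMap (affMap 0 (CFC.sqrt M)⁻¹ (-m)) (CFC.sqrt M)⁻¹ u) ∈ U
        by rw [hinv.2]; exact hu⟩, ⟨fun x hx x' hx' s t hs' ht' hst => ?_,
        fun x hx x' hx' hne s t hs' ht' hst => ?_⟩⟩
    · rw [Set.mem_ofPred_eq, affMap_convex_comb m _ x x' hst]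
      exact hs.1 hx hx' hs' ht' hst
    · have h := hs.2 hx hx' (fun heq => hne ((Function.LeftInverse.injective hinv.1) heq))
        hs' ht' hst
      rw [← affMap_convex_comb m _ x x' hst] at h
      simp only [whitenedLog_join hy (hlc y hy), smul_eq_mul] at h ⊢
      have : Real.log (marginalDensity p y) =
          s * Real.log (marginalDensity p y) + t * Real.log (marginalDensity p y) := by
        rw [← add_mul, hst, one_mul]
      linarith

/-- The shape of a minimizer, in the original and in the whitened coordinates. -/
lemma IsReverseKLMinimizer.exists_scale (hp : IsProbDensity p)
    (hfin : ∃ (ν : EuclideanSpace ℝ (σ ⊕ τ)) (S : Matrix (σ ⊕ τ) (σ ⊕ τ) ℝ),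
      S.PosDef ∧ reverseKL p ν S ≠ ∞) [Nonempty σ]
    {m : EuclideanSpace ℝ σ} {M : Matrix σ σ ℝ} (hM : M.PosDef)
    (hK : IsRadialConcave (whitenedLog p m M))
    {ν : EuclideanSpace ℝ (σ ⊕ τ)} {S : Matrix (σ ⊕ τ) (σ ⊕ τ) ℝ}
    (h : IsReverseKLMinimizer p ν S) :
    fstPart ν = m ∧ (CFC.sqrt S.toBlocks₂₂).det ≠ 0 ∧ ∃ c : ℝ, 0 < c ∧ S.toBlocks₁₁ = c ^ 2 • M ∧
      MinimizesFreeEnergy (whitenedLog p m M) (join 0 (sndPart ν))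
        (Matrix.fromBlocks (Matrix.diagonal fun _ => c) 0 0 (CFC.sqrt S.toBlocks₂₂)) := by
  have hN := det_whitening_ne_zero (τ := τ) hM
  have hNu : IsUnit (whitening τ M).det := isUnit_iff_ne_zero.2 hN
  have hNinv : ((whitening τ M)⁻¹).transpose = (whitening τ M)⁻¹ := by
    rw [Matrix.transpose_nonsing_inv, transpose_whitening]
  set S' := (whitening τ M)⁻¹ * S * (whitening τ M)⁻¹ with hS'
  have hS'pos : S'.PosDef := by
    have hB : ((whitening τ M)⁻¹ * CFC.sqrt S).det ≠ 0 := by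
      rw [Matrix.det_mul, Matrix.det_nonsing_inv, Ring.inverse_eq_inv']
      exact mul_ne_zero (inv_ne_zero hN) (isUnit_det_sqrt h.1)
    have := posDef_mul_transpose_self hB
    rwa [Matrix.transpose_mul, hNinv, Matrix.mul_assoc, ← Matrix.mul_assoc (CFC.sqrt S),
      sqrt_mul_transpose h.1, ← Matrix.mul_assoc] at this
  have hSS' : S = whitening τ M * S' * whitening τ M := by
    rw [hS', ← Matrix.mul_assoc, ← Matrix.mul_assoc, Matrix.mul_nonsing_inv _ hNu, Matrix.one_mul,
      Matrix.mul_assoc, Matrix.nonsing_inv_mul _ hNu, Matrix.mul_one]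
  have hblocks : S = Matrix.fromBlocks (CFC.sqrt M * S'.toBlocks₁₁ * CFC.sqrt M)
      (CFC.sqrt M * S'.toBlocks₁₂) (S'.toBlocks₂₁ * CFC.sqrt M) S'.toBlocks₂₂ := by
    conv_lhs => rw [hSS', ← Matrix.fromBlocks_toBlocks S', whitening]
    simp [Matrix.fromBlocks_multiply]
  -- Whitening fixes `τ`, so the factor `D` depends only on the `τ`-marginal of the original
  -- minimizer; uniqueness for a given marginal relies on this.
  have h22 : S.toBlocks₂₂ = S'.toBlocks₂₂ := by
    conv_lhs => rw [hblocks, Matrix.toBlocks_fromBlocks₂₂]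
  have h11 : S.toBlocks₁₁ = CFC.sqrt M * S'.toBlocks₁₁ * CFC.sqrt M := by
    conv_lhs => rw [hblocks, Matrix.toBlocks_fromBlocks₁₁]
  obtain ⟨O, l, A, hO, hl, hD, hfac⟩ := exists_blockTriangular_factorization hS'pos
  rw [← h22] at hD hfac
  set D := CFC.sqrt S.toBlocks₂₂ with hDdef
  set B := Matrix.fromBlocks (O * Matrix.diagonal l) A 0 D with hBdef
  have hC : (O * Matrix.diagonal l).det ≠ 0 := by
    rw [Matrix.det_mul, Matrix.det_diagonal]
    refine mul_ne_zero (abs_ne_zero.1 ?_) (Finset.prod_pos fun i _ => hl i).ne'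
    rw [abs_det_orthogonal hO]; exact one_ne_zero
  have hB : B.det ≠ 0 := by
    rw [hBdef, Matrix.det_fromBlocks_zero₂₁]; exact mul_ne_zero hC hD
  have hSfac : S = (whitening τ M * B) * (whitening τ M * B).transpose := by
    rw [Matrix.transpose_mul, transpose_whitening, Matrix.mul_assoc, ← Matrix.mul_assoc B, ← hfac,
      ← Matrix.mul_assoc]
    exact hSS'
  have hNB : (whitening τ M * B).det ≠ 0 := by
    rw [Matrix.det_mul]; exact mul_ne_zero hN hB
  set a := affMap (affMap 0 (whitening τ M)⁻¹ (-join m 0)) (whitening τ M)⁻¹ ν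
  have ha : affMap (join m 0) (whitening τ M) a = ν := (exists_affMap_inv _ hN).2 ν
  have hmin : MinimizesFreeEnergy (whitenedLog p m M) a B := by
    refine MinimizesFreeEnergy.comp_affMap (K := fun z => Real.log (p z)) (c := join m 0) hN hB ?_
    rw [ha]
    refine IsReverseKLMinimizer.minimizesFreeEnergy hp hfin hNB ?_
    rwa [← hSfac]
  obtain ⟨ha0, hA⟩ := hK.fstPart_eq_zero_and_eq_zero hC hD hmin
  have haj : a = join 0 (sndPart a) := by rw [← ha0, join_fstPart_sndPart]
  have hνj : ν = join m (sndPart a) := by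
    rw [← ha]
    conv_lhs => rw [haj, affMap_whitening_join]
    simp [affMap]
  rw [hBdef, hA] at hmin
  have hmin2 := hK.minimizes_diagonal ha0 hO hD hl hmin
  obtain ⟨i₀⟩ := ‹Nonempty σ›
  have hconst : l = fun _ => l i₀ := funext fun i => hK.diagonal_const ha0 hD hl hmin2 i i₀
  refine ⟨by rw [hνj, fstPart_join], hD, l i₀, hl i₀, ?_, ?_⟩
  · rw [h11, hfac, hBdef, hA, Matrix.fromBlocks_transpose, Matrix.fromBlocks_multiply,
      Matrix.toBlocks_fromBlocks₁₁, Matrix.transpose_mul, Matrix.diagonal_transpose,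
      Matrix.mul_assoc O, ← Matrix.mul_assoc (Matrix.diagonal l), Matrix.diagonal_mul_diagonal,
      hconst]
    have : (Matrix.diagonal fun _ : σ => l i₀ * l i₀) = (l i₀ ^ 2) • (1 : Matrix σ σ ℝ) := by
      rw [Matrix.smul_one_eq_diagonal, sq]
    rw [this]
    simp [hO, CFC.sqrt_mul_sqrt_self M hM.posSemidef.nonneg]
  · rw [hνj, sndPart_join, ← haj, ← hconst]
    exact hmin2

end Whitening

/-! ### Mean and covariance of `p` along `σ`. -/

section Moments

variable {σ τ : Type*} [Fintype σ] [Fintype τ] [DecidableEq σ] [DecidableEq τ]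
variable {p : EuclideanSpace ℝ (σ ⊕ τ) → ℝ} {m : EuclideanSpace ℝ σ} {M : Matrix σ σ ℝ}

/-- The law of the whitened coordinates. -/
def whitenedMeasure (p : EuclideanSpace ℝ (σ ⊕ τ) → ℝ) (m : EuclideanSpace ℝ σ)
    (M : Matrix σ σ ℝ) : Measure (EuclideanSpace ℝ (σ ⊕ τ)) :=
  pullbackMeasure p (join m 0) (whitening τ M)

lemma measurePreserving_whitening (hp : IsProbDensity p) (hM : M.PosDef) :
    MeasurePreserving (affMap (join m 0) (whitening τ M)) (whitenedMeasure p m M)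
      (densityMeasure p) :=
  ⟨measurable_affMap _ _, map_affMap_withDensity _ (det_whitening_ne_zero hM) hp.measurable⟩

/-- Radiality makes the whitened density invariant almost everywhere, and the map has `|det| = 1`.
-/
lemma measurePreserving_orthogonal (hp : IsProbDensity p) (hpos : ∀ᵐ z, 0 < p z)
    (hM : M.PosDef) (hK : IsRadialConcave (whitenedLog p m M)) {O : Matrix σ σ ℝ}
    (hO : O * O.transpose = 1) :
    MeasurePreserving (affMap 0 (Matrix.fromBlocks O 0 0 1)) (whitenedMeasure p m M)
      (whitenedMeasure p m M) := by
  have hdet : |(Matrix.fromBlocks O 0 0 (1 : Matrix τ τ ℝ)).det| = 1 := by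
    rw [Matrix.det_fromBlocks_zero₂₁, Matrix.det_one, mul_one, abs_det_orthogonal hO]
  have hdet' : (Matrix.fromBlocks O 0 0 (1 : Matrix τ τ ℝ)).det ≠ 0 := by
    rw [← abs_pos, hdet]; exact one_pos
  have hN := det_whitening_ne_zero (τ := τ) hM
  have hpos' := (quasiMeasurePreserving_affMap (join m 0) hN).ae hpos
  have hpos'' := (quasiMeasurePreserving_affMap 0 hdet').ae hpos'
  have hae : ∀ᵐ z, p (affMap (join m 0) (whitening τ M)
      (affMap 0 (Matrix.fromBlocks O 0 0 1) z)) = p (affMap (join m 0) (whitening τ M) z) := by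
    filter_upwards [hpos', hpos'', ae_sndPart (σ := σ) hK.radial] with z hz hz' hrad
    have h := hrad (fstPart (affMap 0 (Matrix.fromBlocks O 0 0 1) z)) (fstPart z) (by
      rw [fstPart_affMap_orthogonal, norm_toLp_orthogonal_mulVec hO])
    rw [join_fstPart_sndPart, ← sndPart_affMap_orthogonal O z, join_fstPart_sndPart] at h
    rw [← Real.exp_log hz, ← Real.exp_log hz']
    exact congrArg Real.exp h
  refine ⟨measurable_affMap _ _, ?_⟩
  have hm : Measurable fun z => ENNReal.ofReal (|(whitening τ M).det| *
      p (affMap (join m 0) (whitening τ M) z)) :=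
    ((hp.measurable.comp (measurable_affMap _ _)).const_mul _).ennreal_ofReal
  have h1 : whitenedMeasure p m M = volume.withDensity fun z =>
      ENNReal.ofReal (|(whitening τ M).det| * p (affMap (join m 0) (whitening τ M)
        (affMap 0 (Matrix.fromBlocks O 0 0 1) z))) := by
    refine withDensity_congr_ae ?_
    filter_upwards [hae] with z hz
    rw [hz]
  conv_lhs => rw [h1]
  rw [map_withDensity_comp volume (measurable_affMap _ _) hm, map_affMap_volume _ hdet', hdet]
  simp [whitenedMeasure, pullbackMeasure]

/-- Whitened coordinates are linear combinations, through `(√M)⁻¹`, of the centred original ones. -/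
lemma memLp_whitened (hp : IsProbDensity p) (hM : M.PosDef)
    (hmom : ∀ i : σ, MemLp (fun z : EuclideanSpace ℝ (σ ⊕ τ) => z (Sum.inl i)) 2
      (densityMeasure p)) (i : σ) :
    MemLp (fun w : EuclideanSpace ℝ (σ ⊕ τ) => w (Sum.inl i)) 2 (whitenedMeasure p m M) := by
  have := hp.isProbabilityMeasure_pullback (join m 0) (det_whitening_ne_zero (τ := τ) hM)
  have : IsProbabilityMeasure (whitenedMeasure p m M) := this
  have hu : IsUnit (CFC.sqrt M).det := isUnit_iff_ne_zero.2 (isUnit_det_sqrt hM)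
  have h1 : ∀ j : σ, MemLp (fun w : EuclideanSpace ℝ (σ ⊕ τ) =>
      (CFC.sqrt M)⁻¹ i j * (affMap (join m 0) (whitening τ M) w (Sum.inl j) - m j)) 2
      (whitenedMeasure p m M) := fun j =>
    ((((hmom j).comp_measurePreserving (measurePreserving_whitening hp hM)).sub
      (memLp_const (m j))).const_mul _)
  refine (memLp_finsetSum Finset.univ fun j _ => h1 j).ae_eq (.of_forall fun w => ?_)
  have h2 : (fun j => affMap (join m 0) (whitening τ M) w (Sum.inl j) - m j) =
      (CFC.sqrt M).mulVec (fstPart w).ofLp := by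
    have h3 : fstPart (affMap (join m 0) (whitening τ M) w) =
        m + WithLp.toLp 2 ((CFC.sqrt M).mulVec (fstPart w).ofLp) := by
      rw [whitening, fstPart_affMap, fstPart_join, Matrix.zero_mulVec, add_zero]
    funext j
    have := congrFun (congrArg WithLp.ofLp h3) j
    change affMap (join m 0) (whitening τ M) w (Sum.inl j) = _ at this
    rw [this]
    simp
  have h4 := congrFun (congrArg ((CFC.sqrt M)⁻¹.mulVec) h2) i
  rw [Matrix.mulVec_mulVec, Matrix.nonsing_inv_mul _ hu, Matrix.one_mulVec] at h4
  exact h4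

lemma affMap_whitening_apply (w : EuclideanSpace ℝ (σ ⊕ τ)) (i : σ) :
    affMap (join m 0) (whitening τ M) w (Sum.inl i) =
      m i + ∑ k, CFC.sqrt M i k * w (Sum.inl k) := by
  have h3 : fstPart (affMap (join m 0) (whitening τ M) w) =
      m + WithLp.toLp 2 ((CFC.sqrt M).mulVec (fstPart w).ofLp) := by
    rw [whitening, fstPart_affMap, fstPart_join, Matrix.zero_mulVec, add_zero]
  exact congrFun (congrArg WithLp.ofLp h3) i

lemma affMap_orthogonal_apply (O : Matrix σ σ ℝ) (w : EuclideanSpace ℝ (σ ⊕ τ)) (i : σ) :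
    affMap 0 (Matrix.fromBlocks O 0 0 1) w (Sum.inl i) =
      O.mulVec (fun k => w (Sum.inl k)) i :=
  congrFun (congrArg WithLp.ofLp (fstPart_affMap_orthogonal O w)) i

lemma integral_whitened_eq (hp : IsProbDensity p) (hpos : ∀ᵐ z, 0 < p z)
    (hM : M.PosDef) (hK : IsRadialConcave (whitenedLog p m M)) {O : Matrix σ σ ℝ}
    (hO : O * O.transpose = 1) {f : (σ → ℝ) → ℝ} (hf : Measurable f) :
    ∫ w, f (O.mulVec fun k => w (Sum.inl k)) ∂(whitenedMeasure p m M) =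
      ∫ w, f (fun k => w (Sum.inl k)) ∂(whitenedMeasure p m M) := by
  have hmp := measurePreserving_orthogonal hp hpos hM hK hO
  have hm : Measurable fun w : EuclideanSpace ℝ (σ ⊕ τ) => f fun k => w (Sum.inl k) :=
    hf.comp (by fun_prop)
  conv_rhs => rw [← hmp.map_eq]
  rw [integral_map hmp.measurable.aemeasurable hm.aestronglyMeasurable]
  simp only [affMap_orthogonal_apply]

lemma integral_whitened_coord (hp : IsProbDensity p) (hpos : ∀ᵐ z, 0 < p z)
    (hM : M.PosDef) (hK : IsRadialConcave (whitenedLog p m M)) (i : σ) :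
    ∫ w, w (Sum.inl i) ∂(whitenedMeasure p m M) = 0 := by
  have h := integral_whitened_eq hp hpos hM hK (O := -1) (by simp) (f := fun v => v i)
    (measurable_pi_apply i)
  simp only [Matrix.neg_mulVec, Matrix.one_mulVec, Pi.neg_apply] at h
  rw [integral_neg] at h
  linarith

lemma exists_integral_whitened_mul (hp : IsProbDensity p) (hpos : ∀ᵐ z, 0 < p z)
    [Nonempty σ] (hM : M.PosDef) (hK : IsRadialConcave (whitenedLog p m M))
    (hmom : ∀ i : σ, MemLp (fun z : EuclideanSpace ℝ (σ ⊕ τ) => z (Sum.inl i)) 2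
      (densityMeasure p)) :
    ∃ s : ℝ, 0 < s ∧ ∀ i j : σ, ∫ w, w (Sum.inl i) * w (Sum.inl j) ∂(whitenedMeasure p m M) =
      if i = j then s else 0 := by
  obtain ⟨i₀⟩ := ‹Nonempty σ›
  refine ⟨∫ w, w (Sum.inl i₀) * w (Sum.inl i₀) ∂(whitenedMeasure p m M), ?_, fun i j => ?_⟩
  · have hint : Integrable (fun w : EuclideanSpace ℝ (σ ⊕ τ) => w (Sum.inl i₀) * w (Sum.inl i₀))
        (whitenedMeasure p m M) :=
      (memLp_whitened hp hM hmom i₀).integrable_mul (memLp_whitened hp hM hmom i₀)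
    have h0 : 0 ≤ᵐ[whitenedMeasure p m M] fun w : EuclideanSpace ℝ (σ ⊕ τ) =>
        w (Sum.inl i₀) * w (Sum.inl i₀) := .of_forall fun w => mul_self_nonneg _
    refine (integral_nonneg_of_ae h0).lt_of_ne' fun heq => ?_
    have h1 := (integral_eq_zero_iff_of_nonneg_ae h0 hint).1 heq
    have hm : Measurable fun z => ENNReal.ofReal (|(whitening τ M).det| *
        p (affMap (join m 0) (whitening τ M) z)) :=
      ((hp.measurable.comp (measurable_affMap _ _)).const_mul _).ennreal_ofReal
    have hN := det_whitening_ne_zero (τ := τ) hM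
    have hac : (volume : Measure (EuclideanSpace ℝ (σ ⊕ τ))) ≪ whitenedMeasure p m M := by
      refine withDensity_absolutelyContinuous' hm.aemeasurable ?_
      filter_upwards [(quasiMeasurePreserving_affMap (join m 0) hN).ae hpos] with z hz
      exact (ENNReal.ofReal_pos.2 (mul_pos (abs_pos.2 hN) hz)).ne'
    -- If the second moment vanished, the continuous function `w_i₀²` would vanish identically,
    -- which fails at a basis vector.
    have h2 := (Continuous.ae_eq_iff_eq volume (by fun_prop) (by fun_prop)).1 (hac.ae_le h1)
    have := congrFun h2 (EuclideanSpace.single (Sum.inl i₀) 1)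
    simp at this
  · split_ifs with hij
    · subst hij
      -- A coordinate swap equates the diagonal moments; the sign flip of coordinate `i` below kills
      -- the off-diagonal ones.
      have h := integral_whitened_eq hp hpos hM hK (O := (Equiv.swap i i₀).permMatrix ℝ)
        (by rw [Matrix.transpose_permMatrix, ← Matrix.permMatrix_mul]; simp)
        (f := fun v => v i * v i) (by fun_prop)
      simpa [Matrix.permMatrix_mulVec] using h.symm
    · have h := integral_whitened_eq hp hpos hM hK
        (O := Matrix.diagonal fun k => if k = i then -1 else 1)
        (by
          rw [Matrix.diagonal_transpose, Matrix.diagonal_mul_diagonal, ← Matrix.diagonal_one]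
          congr 1; funext k; split_ifs <;> simp)
        (f := fun v => v i * v j) (by fun_prop)
      simp only [Matrix.mulVec_diagonal, if_true, if_neg (Ne.symm hij), neg_mul, one_mul] at h
      rw [integral_neg] at h
      linarith

lemma meanVec_inl_eq (hp : IsProbDensity p) (hpos : ∀ᵐ z, 0 < p z)
    (hM : M.PosDef) (hK : IsRadialConcave (whitenedLog p m M))
    (hmom : ∀ i : σ, MemLp (fun z : EuclideanSpace ℝ (σ ⊕ τ) => z (Sum.inl i)) 2
      (densityMeasure p)) (i : σ) : meanVec (densityMeasure p) (Sum.inl i) = m i := by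
  have : IsProbabilityMeasure (whitenedMeasure p m M) :=
    hp.isProbabilityMeasure_pullback (join m 0) (det_whitening_ne_zero (τ := τ) hM)
  have hmp := measurePreserving_whitening (m := m) hp hM
  have hint : ∀ k : σ, Integrable (fun w : EuclideanSpace ℝ (σ ⊕ τ) => w (Sum.inl k))
    (whitenedMeasure p m M) := fun k => (memLp_whitened hp hM hmom k).integrable (by norm_num)
  rw [meanVec, ← hmp.map_eq, integral_map hmp.measurable.aemeasurable
    (Measurable.aestronglyMeasurable (by fun_prop))]
  simp only [affMap_whitening_apply]
  rw [integral_add (integrable_const _) (integrable_finsetSum _ fun k _ => (hint k).const_mul _),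
    integral_finsetSum _ fun k _ => (hint k).const_mul _]
  simp [integral_const_mul, integral_whitened_coord hp hpos hM hK]

lemma exists_covMat_toBlocks₁₁_eq (hp : IsProbDensity p) (hpos : ∀ᵐ z, 0 < p z) [Nonempty σ]
    (hM : M.PosDef) (hK : IsRadialConcave (whitenedLog p m M))
    (hmom : ∀ i : σ, MemLp (fun z : EuclideanSpace ℝ (σ ⊕ τ) => z (Sum.inl i)) 2
      (densityMeasure p)) :
    ∃ s : ℝ, 0 < s ∧ (covMat (densityMeasure p)).toBlocks₁₁ = s • M := by
  obtain ⟨s, hs, hmul⟩ := exists_integral_whitened_mul hp hpos hM hK hmom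
  refine ⟨s, hs, ?_⟩
  have hmp := measurePreserving_whitening (m := m) hp hM
  have hint : ∀ k l : σ, Integrable (fun w : EuclideanSpace ℝ (σ ⊕ τ) =>
      w (Sum.inl k) * w (Sum.inl l)) (whitenedMeasure p m M) := fun k l =>
    (memLp_whitened hp hM hmom k).integrable_mul (memLp_whitened hp hM hmom l)
  have hmean := meanVec_inl_eq hp hpos hM hK hmom
  ext i j
  have h1 : (covMat (densityMeasure p)).toBlocks₁₁ i j =
      ∫ z, (z (Sum.inl i) - m i) * (z (Sum.inl j) - m j) ∂(densityMeasure p) := by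
    rw [← hmean i, ← hmean j]; rfl
  rw [h1, ← hmp.map_eq, integral_map hmp.measurable.aemeasurable
    (Measurable.aestronglyMeasurable (by fun_prop))]
  simp only [affMap_whitening_apply, add_sub_cancel_left, Finset.sum_mul_sum]
  have h2 : ∀ k l : σ, Integrable (fun w : EuclideanSpace ℝ (σ ⊕ τ) =>
      CFC.sqrt M i k * w (Sum.inl k) * (CFC.sqrt M j l * w (Sum.inl l)))
      (whitenedMeasure p m M) := fun k l =>
    ((hint k l).const_mul (CFC.sqrt M i k * CFC.sqrt M j l)).congr
      (.of_forall fun w => by simp only []; ring)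
  have h3 : ∀ k l : σ, ∫ w : EuclideanSpace ℝ (σ ⊕ τ),
      CFC.sqrt M i k * w (Sum.inl k) * (CFC.sqrt M j l * w (Sum.inl l)) ∂(whitenedMeasure p m M) =
      CFC.sqrt M i k * CFC.sqrt M j l * if k = l then s else 0 := fun k l => by
    rw [← hmul k l, ← integral_const_mul]
    congr 1; funext w; ring
  rw [integral_finsetSum _ fun k _ => integrable_finsetSum _ fun l _ => h2 k l]
  simp_rw [integral_finsetSum _ fun l _ => h2 _ l, h3]
  have h4 := congrFun (congrFun (sqrt_mul_transpose hM) i) j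
  rw [Matrix.mul_apply] at h4
  rw [Matrix.smul_apply, ← h4]
  simp [Finset.mul_sum, mul_comm]

end Moments

lemma existsUnique_pos_smul {σ : Type*} [Nonempty σ] [Fintype σ] [DecidableEq σ]
    {M : Matrix σ σ ℝ} (hM : M.PosDef) {s c : ℝ} (hs : 0 < s) (hc : 0 < c) :
    ∃! γ : ℝ, 0 < γ ∧ c ^ 2 • M = γ ^ 2 • (s • M) := by
  have hsq : Real.sqrt s ^ 2 = s := Real.sq_sqrt hs.le
  have hs' : 0 < Real.sqrt s := Real.sqrt_pos.2 hs
  -- The condition is `γ² s = c²`; a positive diagonal entry of `M` recovers it from the matrix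
  -- equation.
  refine ⟨c / Real.sqrt s, ⟨div_pos hc hs', ?_⟩, fun γ ⟨hγ, heq⟩ => ?_⟩
  · rw [smul_smul, div_pow, hsq, div_mul_cancel₀ _ hs.ne']
  · obtain ⟨i⟩ := ‹Nonempty σ›
    have hii : M i i ≠ 0 := (hM.diag_pos (i := i)).ne'
    have h1 := congrFun (congrFun heq i) i
    simp only [Matrix.smul_apply, smul_eq_mul] at h1
    rw [← mul_assoc] at h1
    have h2 := mul_right_cancel₀ hii h1
    rw [← hsq, ← mul_pow] at h2
    rw [eq_div_iff hs'.ne']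
    exact ((pow_left_inj₀ hc.le (mul_pos hγ hs').le two_ne_zero).1 h2).symm

end PartialVI

end

/-! ### Assembly of the three conclusions. -/

theorem theorem4 {σ τ : Type*} [Fintype σ] [DecidableEq σ] [Nonempty σ]
    [Fintype τ] [DecidableEq τ]
    (p : EuclideanSpace ℝ (σ ⊕ τ) → ℝ) (hp : PartialVI.IsProbDensity p)
    (hmom : ∀ i : σ, MemLp (fun z : EuclideanSpace ℝ (σ ⊕ τ) => z (Sum.inl i)) 2
      (PartialVI.densityMeasure p))
    (hfin : ∃ (ν : EuclideanSpace ℝ (σ ⊕ τ)) (S : Matrix (σ ⊕ τ) (σ ⊕ τ) ℝ),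
      S.PosDef ∧ PartialVI.reverseKL p ν S ≠ ∞)
    (m : EuclideanSpace ℝ σ) (M : Matrix σ σ ℝ)
    (hell : ∀ y, 0 < PartialVI.marginalDensity p y →
      PartialVI.IsEllipticallySymmetric (PartialVI.condDensity p y) m M)
    (hreg : ∀ y, 0 < PartialVI.marginalDensity p y →
      PartialVI.HasRegularProfile (PartialVI.condDensity p y) m M)
    (hlc : ∀ y, 0 < PartialVI.marginalDensity p y →
      PartialVI.SomewhereStrictlyLogConcave (PartialVI.condDensity p y)) :
    (∀ (ν : EuclideanSpace ℝ (σ ⊕ τ)) (S : Matrix (σ ⊕ τ) (σ ⊕ τ) ℝ),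
      PartialVI.IsReverseKLMinimizer p ν S →
        (∀ i : σ, ν (Sum.inl i) = PartialVI.meanVec (PartialVI.densityMeasure p) (Sum.inl i)) ∧
        ∃! γ : ℝ, 0 < γ ∧ S.toBlocks₁₁ =
          γ ^ 2 • (PartialVI.covMat (PartialVI.densityMeasure p)).toBlocks₁₁) ∧
    (∀ (ν ν' : EuclideanSpace ℝ (σ ⊕ τ)) (S S' : Matrix (σ ⊕ τ) (σ ⊕ τ) ℝ),
      PartialVI.IsReverseKLMinimizer p ν S → PartialVI.IsReverseKLMinimizer p ν' S' →
      (∀ j : τ, ν (Sum.inr j) = ν' (Sum.inr j)) → S.toBlocks₂₂ = S'.toBlocks₂₂ →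
        S.toBlocks₁₁ = S'.toBlocks₁₁) ∧
    ((∀ y y', 0 < PartialVI.marginalDensity p y → 0 < PartialVI.marginalDensity p y' →
        PartialVI.condDensity p y = PartialVI.condDensity p y') →
      ∀ (ν ν' : EuclideanSpace ℝ (σ ⊕ τ)) (S S' : Matrix (σ ⊕ τ) (σ ⊕ τ) ℝ),
        PartialVI.IsReverseKLMinimizer p ν S → PartialVI.IsReverseKLMinimizer p ν' S' →
          S.toBlocks₁₁ = S'.toBlocks₁₁) := by
  have hpos := PartialVI.ae_pos_of_exists_reverseKL_ne_top hp hfin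
  have hmarg := PartialVI.ae_marginalDensity_pos hp hpos
  -- Positive definiteness of `M` is available only through some `y` of positive marginal density;
  -- `y₀` also supplies the reference conditional in the independent case.
  obtain ⟨y₀, hy₀⟩ := hmarg.exists
  have hM : M.PosDef := (hell y₀ hy₀).posDef
  have hK := PartialVI.isRadialConcave_whitenedLog hp hpos hM hell hlc
  obtain ⟨s, hs, hcov⟩ := PartialVI.exists_covMat_toBlocks₁₁_eq hp hpos hM hK hmom
  have hmean := PartialVI.meanVec_inl_eq hp hpos hM hK hmom
  refine ⟨fun ν S h => ?_, fun ν ν' S S' h h' hν hS => ?_, fun hindep ν ν' S S' h h' => ?_⟩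
  · obtain ⟨hfst, -, c, hc, h11, -⟩ := h.exists_scale hp hfin hM hK
    refine ⟨fun i => ?_, ?_⟩
    · rw [hmean i, ← hfst]; rfl
    · rw [hcov, h11]
      exact PartialVI.existsUnique_pos_smul hM hs hc
  · obtain ⟨-, hD, c, hc, h11, hmin⟩ := h.exists_scale hp hfin hM hK
    obtain ⟨-, -, c', hc', h11', hmin'⟩ := h'.exists_scale hp hfin hM hK
    have hsnd : PartialVI.sndPart ν = PartialVI.sndPart ν' := by
      ext j; exact hν j
    rw [← hS, ← hsnd] at hmin'
    -- Both minimizers now share `a` and `D`, so the first is a competitor of the second.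
    have hcc := hK.diagonal_unique hD (fun _ => hc) (fun _ => hc') hmin hmin'.integrable
      (hmin'.le _ _ (PartialVI.log_abs_det_fromBlocks_diagonal hD fun _ => hc).1 hmin.integrable)
    obtain ⟨i⟩ := ‹Nonempty σ›
    rw [h11, h11', show c = c' from congrFun hcc i]
  · obtain ⟨-, hD, c, hc, h11, hmin⟩ := h.exists_scale hp hfin hM hK
    obtain ⟨-, hD', c', hc', h11', hmin'⟩ := h'.exists_scale hp hfin hM hK
    have hsep : ∀ᵐ y, ∀ x, PartialVI.whitenedLog p m M (PartialVI.join x y) =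
        Real.log (PartialVI.condDensity p y₀ (PartialVI.affMap m (CFC.sqrt M) x)) +
          Real.log (PartialVI.marginalDensity p y) := by
      filter_upwards [hmarg] with y hy x
      rw [PartialVI.whitenedLog_join hy (hlc y hy), hindep y y₀ hy hy₀]
    have hcc := hK.diagonal_unique_of_separable
      (k := fun x => Real.log (PartialVI.condDensity p y₀ (PartialVI.affMap m (CFC.sqrt M) x)))
      (h := fun y => Real.log (PartialVI.marginalDensity p y)) hsep
      (PartialVI.fstPart_join _ _) (PartialVI.fstPart_join _ _) hD hD' (fun _ => hc)
      (fun _ => hc') hmin hmin'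
    obtain ⟨i⟩ := ‹Nonempty σ›
    rw [h11, h11', show c = c' from congrFun hcc i]
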